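/- **Setting.** Let $p\ge 5$ be a prime, $k$ a finite field of characteristic $p$, and $m$ an odd integer with $1\le m\le p-1$. Let $V_m$ be the space of homogeneous polynomials of degree $m$ in $k[x,y]$. Let $\beta$ be the bilinear form on $V_m$ with $\beta(x^ay^b,x^cy^d)=(-1)^a\binom{m}{a}^{-1}$ if $a=d$, and $0$ if $a\neq d$. Let $Q=V_m\times k$ with the multiplication $(v,y)(w,z)=(v+w,\,y+z+\beta(v,w))$. A matrix $A=\begin{pmatrix}\alpha&\beta'\\ \gamma&\delta\end{pmatrix}\in \mathrm{GL}_2(k)$ acts on $k[x,y]$ from the right by the substitution $x\mapsto \alpha x+\beta' y$, $y\mapsto \gamma x+\delta y$, written $v\mapsto v\cdot A$. The group $L=k^\times\times \mathrm{GL}_2(k)$ acts on $Q$ from the right by $$(v,z)^{(t,A)}=\bigl(t\,(v\cdot A),\ t^2(\det A)^m z\bigr).$$ Let $P=LQ$ be the semidirect product and $P_1=P/C_L(Q)$. Let $$S_0=\{1\}\times\left\{\begin{pmatrix}1&0\\ \gamma&1\end{pmatrix} : \gamma\in k\right\}\le L,\qquad S=S_0Q .$$ Let $K$ be the group of all elements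 of $\mathrm{SL}_3(k)$ with first row $(1,0,0)$, let $W=O_p(K)$ be its largest normal $p$-subgroup, and let $$C=\left\{\begin{pmatrix}1&0&0\\ \alpha&\theta&0\\ \delta&\epsilon&\theta^{-1}\end{pmatrix} : \alpha,\delta,\epsilon\in k,\ \theta\in k^\times\right\}\le K .$$ Let $W_0\le P_1$ be a subgroup and $\varphi:C\to N_{P_1}(W_0)$ an isomorphism with $\varphi(W)=W_0$. Let $G=P_1 *_C K$ be the amalgamated product formed by means of $\varphi$ and the inclusion $C\le K$, and regard $S$ as a subgroup of $G$ via $S\to P_1\to G$. The *Parker–Stroth fusion system* is $\mathcal F=\mathcal F_S(G)$: its objects are the subgroups of $S$, and its morphisms are the maps between them induced by conjugation with elements of $G$. A subgroup $N\le S$ is *strongly $\mathcal F$-closed* if every morphism of $\mathcal F$ maps the elements of $N$ in its domain to elements of $N$. The fusion system $\mathcal F$ is *reduction simple* if $S$ has no non-trivial proper strongly $\mathcal F$-closed subgroup. **Lemma 3.1.** Every Parker–Stroth fusion system is reduction simple: the only strongly $\mathcal F$-closed subgroups of $S$ are $1$ and $S$. -/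

import Mathlib

universe u

/-! ## Fusion systems -/

/-- A fusion system on a group `S` (in practice a finite `p`-group; saturation is not imposed):
a category whose objects are the subgroups of `S` and whose morphisms are injective group
homomorphisms, containing all conjugation maps by elements of `S`, and such that every morphism
factors as an isomorphism of the category followed by an inclusion. -/
structure FusionSystem (S : Type u) [Group S] where
  /-- the set of morphisms from `A` to `B` -/
  Hom : ∀ A B : Subgroup S, Set (A →* B)
  injective : ∀ {A B : Subgroup S} (f : A →* B), f ∈ Hom A B → Function.Injective f
  conj_mem : ∀ {A B : Subgroup S} (s : S) (f : A →* B),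
    (∀ x : A, (f x : S) = s * x * s⁻¹) → f ∈ Hom A B
  comp_mem : ∀ {A B D : Subgroup S} (f : A →* B) (g : B →* D),
    f ∈ Hom A B → g ∈ Hom B D → g.comp f ∈ Hom A D
  factor : ∀ {A B : Subgroup S} (f : A →* B), f ∈ Hom A B →
    ∃ (D : Subgroup S) (e : A ≃* D), D ≤ B ∧ (∀ x : A, (e x : S) = f x) ∧
      e.toMonoidHom ∈ Hom A D ∧ e.symm.toMonoidHom ∈ Hom D A

namespace FusionSystem

/-- The fusion system `F_S(G)` of a group `G` on a subgroup `S`: the morphisms are the maps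
induced by conjugation with elements of `G`. -/
def ofGroup {G : Type u} [Group G] (S : Subgroup G) : FusionSystem S where
  Hom A B := {f | ∃ g : G, ∀ x : A, ((f x : S) : G) = g * ((x : S) : G) * g⁻¹}
  injective := by
    rintro A B f ⟨g, hg⟩ x y hxy
    have h := hg x
    rw [hxy, hg y] at h
    have h2 : ((y : S) : G) = ((x : S) : G) := by simpa using h
    exact Subtype.ext (Subtype.ext h2.symm)
  conj_mem := by
    intro A B s f hf
    exact ⟨s, fun x => by rw [hf x]; rfl⟩
  comp_mem := by
    rintro A B D f g ⟨a, ha⟩ ⟨b, hb⟩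
    refine ⟨b * a, fun x => ?_⟩
    rw [MonoidHom.comp_apply, hb, ha]
    group
  factor := by
    rintro A B f ⟨g, hg⟩
    have hinj : Function.Injective (B.subtype.comp f) := by
      intro x y hxy
      have hxy' : ((f x : S) : G) = ((f y : S) : G) := congrArg Subtype.val hxy
      rw [hg x, hg y] at hxy'
      have h2 : ((x : S) : G) = ((y : S) : G) := by simpa using hxy'
      exact Subtype.ext (Subtype.ext h2)
    let e := MonoidHom.ofInjective hinj
    refine ⟨(B.subtype.comp f).range, e, ?_, fun x => rfl, ⟨g, fun x => hg x⟩, ⟨g⁻¹, ?_⟩⟩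
    · rintro _ ⟨x, rfl⟩
      exact (f x).2
    · intro y
      obtain ⟨x, rfl⟩ := e.surjective y
      have h : (((e x : (B.subtype.comp f).range) : S) : G) = g * ((x : S) : G) * g⁻¹ := hg x
      have h' : e.symm.toMonoidHom (e x) = x := e.symm_apply_apply x
      rw [h', h]
      group

/-- `N ≤ S` is strongly closed in `F` if every morphism of `F` maps elements of `N` to
elements of `N`. -/
def StronglyClosed {S : Type u} [Group S] (F : FusionSystem S) (N : Subgroup S) : Prop :=
  ∀ (A B : Subgroup S) (f : A →* B), f ∈ F.Hom A B → ∀ x : A, (x : S) ∈ N → (f x : S) ∈ N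

/-- `F` is reduction simple if `S` has no non-trivial proper strongly `F`-closed subgroup. -/
def ReductionSimple {S : Type u} [Group S] (F : FusionSystem S) : Prop :=
  ∀ N : Subgroup S, F.StronglyClosed N → N = ⊥ ∨ N = ⊤

end FusionSystem

/-- `O_p(G)`: the subgroup generated by all normal `p`-subgroups of `G` (for finite `G`, the
largest normal `p`-subgroup). -/
def normalPCore (p : ℕ) (G : Type u) [Group G] : Subgroup G :=
  sSup {N : Subgroup G | N.Normal ∧ IsPGroup p N}

namespace ParkerStroth

open MvPolynomial

/-! ## The group `Q` -/

/-- `V_m`: homogeneous polynomials of degree `m` in `k[x, y]`, where `x = X 0` and `y = X 1`. -/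
abbrev V (k : Type u) [Field k] (m : ℕ) : Type u := homogeneousSubmodule (Fin 2) k m

/-- The exponent of the monomial `x ^ a * y ^ b`. -/
noncomputable def expo (a b : ℕ) : Fin 2 →₀ ℕ := Finsupp.single 0 a + Finsupp.single 1 b

/-- The bilinear form on `V_m` with `β (x^a y^b) (x^c y^d) = (-1)^a / (m choose a)` if `a = d`,
and `0` if `a ≠ d`. -/
noncomputable def form (k : Type u) [Field k] (m : ℕ) : V k m →ₗ[k] V k m →ₗ[k] k :=
  LinearMap.mk₂ k
    (fun v w => ∑ a ∈ Finset.range (m + 1),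
      ((-1) ^ a / (m.choose a : k)) * coeff (expo a (m - a)) v.1 * coeff (expo (m - a) a) w.1)
    (fun v v' w => by
      rw [← Finset.sum_add_distrib]
      refine Finset.sum_congr rfl fun a _ => ?_
      simp only [Submodule.coe_add, coeff_add]; ring)
    (fun c v w => by
      rw [Finset.smul_sum]
      refine Finset.sum_congr rfl fun a _ => ?_
      simp only [Submodule.coe_smul, coeff_smul, smul_eq_mul]; ring)
    (fun v w w' => by
      rw [← Finset.sum_add_distrib]
      refine Finset.sum_congr rfl fun a _ => ?_
      simp only [Submodule.coe_add, coeff_add]; ring)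
    (fun c v w => by
      rw [Finset.smul_sum]
      refine Finset.sum_congr rfl fun a _ => ?_
      simp only [Submodule.coe_smul, coeff_smul, smul_eq_mul]; ring)

theorem form_apply (k : Type u) [Field k] (m : ℕ) (v w : V k m) :
    form k m v w = ∑ a ∈ Finset.range (m + 1),
      ((-1) ^ a / (m.choose a : k)) * coeff (expo a (m - a)) v.1 * coeff (expo (m - a) a) w.1 :=
  rfl

/-- The underlying set of `Q` is `V_m × k`. -/
@[ext] structure Q (k : Type u) [Field k] (m : ℕ) : Type u where
  vec : V k m
  cen : k

namespace Q

/-- The group law of `Q` is `(v, y) (w, z) = (v + w, y + z + β v w)`. -/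
noncomputable instance group (k : Type u) [Field k] (m : ℕ) : Group (Q k m) :=
  letI : Mul (Q k m) := ⟨fun q r => ⟨q.vec + r.vec, q.cen + r.cen + form k m q.vec r.vec⟩⟩
  letI : One (Q k m) := ⟨⟨0, 0⟩⟩
  letI : Inv (Q k m) := ⟨fun q => ⟨-q.vec, -q.cen + form k m q.vec q.vec⟩⟩
  Group.ofLeftAxioms
    (fun a b c => by
      apply Q.ext
      · exact add_assoc _ _ _
      · change a.cen + b.cen + form k m a.vec b.vec + c.cen + form k m (a.vec + b.vec) c.vec
          = a.cen + (b.cen + c.cen + form k m b.vec c.vec) + form k m a.vec (b.vec + c.vec)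
        simp only [map_add, LinearMap.add_apply]; ring)
    (fun a => by
      apply Q.ext
      · exact zero_add _
      · change 0 + a.cen + form k m 0 a.vec = a.cen
        simp)
    (fun a => by
      apply Q.ext
      · exact neg_add_cancel _
      · change -a.cen + form k m a.vec a.vec + a.cen + form k m (-a.vec) a.vec = 0
        simp only [map_neg, LinearMap.neg_apply]; ring)

theorem mul_vec {k : Type u} [Field k] {m : ℕ} (q r : Q k m) : (q * r).vec = q.vec + r.vec := rfl

theorem mul_cen {k : Type u} [Field k] {m : ℕ} (q r : Q k m) :
    (q * r).cen = q.cen + r.cen + form k m q.vec r.vec := rfl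

end Q

/-! ## The action of `L` on `Q` -/

/-- `L = kˣ × GL₂(k)`. -/
abbrev L (k : Type u) [Field k] : Type u := kˣ × GL (Fin 2) k

/-- The right action `f ↦ f · A` of matrices on `k[x, y]` by linear substitution: for
`A = !![α, β; γ, δ]`, `x · A = α x + β y` and `y · A = γ x + δ y`. -/
noncomputable def subst {k : Type u} [Field k] (A : Matrix (Fin 2) (Fin 2) k) :
    MvPolynomial (Fin 2) k →ₐ[k] MvPolynomial (Fin 2) k :=
  aeval fun i => ∑ j, C (A i j) * X j

theorem subst_mul {k : Type u} [Field k] (A B : Matrix (Fin 2) (Fin 2) k)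
    (f : MvPolynomial (Fin 2) k) : subst (A * B) f = subst B (subst A f) := by
  have h : subst (A * B) = (subst B).comp (subst A) := by
    apply MvPolynomial.algHom_ext
    intro i
    simp only [subst, AlgHom.comp_apply, aeval_X, map_mul, algHom_C, Matrix.mul_apply,
      Fin.sum_univ_two, map_add, algebraMap_eq]
    ring
  rw [h]; rfl

theorem subst_one {k : Type u} [Field k] (f : MvPolynomial (Fin 2) k) :
    subst (1 : Matrix (Fin 2) (Fin 2) k) f = f := by
  have h : subst (1 : Matrix (Fin 2) (Fin 2) k) = AlgHom.id k _ := by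
    apply MvPolynomial.algHom_ext
    intro i
    fin_cases i <;> simp [subst, Fin.sum_univ_two]
  rw [h]; rfl

theorem subst_isHomogeneous {k : Type u} [Field k] {m : ℕ} (A : Matrix (Fin 2) (Fin 2) k)
    {f : MvPolynomial (Fin 2) k} (hf : f.IsHomogeneous m) : (subst A f).IsHomogeneous m := by
  have := hf.aeval (fun i => ∑ j, C (A i j) * X j : Fin 2 → MvPolynomial (Fin 2) k)
    (n := 1) (fun i => IsHomogeneous.sum _ _ _ fun j _ => (isHomogeneous_X k j).C_mul (A i j))
  simpa [subst] using this

/-- The right action of matrices on `V_m`. -/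
noncomputable def substV {k : Type u} [Field k] (m : ℕ) (A : Matrix (Fin 2) (Fin 2) k) :
    V k m →ₗ[k] V k m :=
  (subst A).toLinearMap.restrict fun _ hf => subst_isHomogeneous A hf

theorem expo_inj {a b c d : ℕ} : expo a b = expo c d ↔ a = c ∧ b = d := by
  constructor
  · intro h
    have h0 := DFunLike.congr_fun h 0
    have h1 := DFunLike.congr_fun h 1
    simpa [expo] using And.intro h0 h1
  · rintro ⟨rfl, rfl⟩; rfl

theorem monomial_expo {k : Type u} [Field k] (a b : ℕ) (r : k) :
    monomial (expo a b) r = C r * X 0 ^ a * X 1 ^ b := by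
  rw [expo, monomial_eq, Finsupp.prod_add_index', Finsupp.prod_single_index,
    Finsupp.prod_single_index, mul_assoc]
  all_goals simp [pow_add]

/-- The monomial `x ^ a * y ^ (m - a)` as an element of `V_m`. -/
noncomputable def mono (k : Type u) [Field k] {m : ℕ} (a : ℕ) (ha : a ≤ m) : V k m :=
  ⟨monomial (expo a (m - a)) 1, isHomogeneous_monomial _ (by
    simp [expo, Finsupp.degree_eq_sum, Fin.sum_univ_two]; omega)⟩

theorem V_eq_sum {k : Type u} [Field k] {m : ℕ} (v : MvPolynomial (Fin 2) k)
    (hv : v.IsHomogeneous m) :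
    v = ∑ a ∈ Finset.range (m + 1), monomial (expo a (m - a)) (coeff (expo a (m - a)) v) := by
  ext d
  have hd : d = expo (d 0) (d 1) := by
    ext i; fin_cases i <;> simp [expo]
  rw [coeff_sum]
  simp only [coeff_monomial]
  by_cases h : d 0 + d 1 = m
  · rw [Finset.sum_eq_single (d 0)]
    · have : m - d 0 = d 1 := by omega
      rw [this, ← hd]; simp
    · intro b _ hb
      rw [if_neg]
      intro h'
      rw [hd, expo_inj] at h'
      exact hb h'.1
    · intro h'
      simp at h'; omega
  · rw [Finset.sum_eq_zero]
    · apply hv.coeff_eq_zero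
      rw [Finsupp.degree_eq_sum, Fin.sum_univ_two]; exact h
    · intro b hb
      rw [if_neg]
      intro h'
      rw [hd, expo_inj] at h'
      simp at hb
      omega

theorem V_eval {k : Type u} [Field k] {m : ℕ} (v : MvPolynomial (Fin 2) k)
    (hv : v.IsHomogeneous m) (x : Fin 2 → k) :
    eval x v = ∑ a ∈ Finset.range (m + 1),
      coeff (expo a (m - a)) v * x 0 ^ a * x 1 ^ (m - a) := by
  conv_lhs => rw [V_eq_sum v hv]
  simp [monomial_expo]

/-- The `m`-th power of the linear form `c x + d y`. -/
noncomputable def linPow {k : Type u} [Field k] (m : ℕ) (c d : k) : V k m :=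
  ⟨(C c * X 0 + C d * X 1) ^ m, by
    simpa using (((isHomogeneous_X k (0 : Fin 2)).C_mul c).add
      ((isHomogeneous_X k (1 : Fin 2)).C_mul d)).pow m⟩

theorem linPow_eq {k : Type u} [Field k] (m : ℕ) (c d : k) :
    (linPow m c d).1 = ∑ a ∈ Finset.range (m + 1),
      monomial (expo a (m - a)) (c ^ a * d ^ (m - a) * (m.choose a : k)) := by
  simp only [linPow, add_pow, monomial_expo]
  refine Finset.sum_congr rfl fun a _ => ?_
  simp only [map_mul, map_pow, map_natCast]
  ring

theorem coeff_linPow {k : Type u} [Field k] (m : ℕ) (c d : k) (a : ℕ) (ha : a ≤ m) :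
    coeff (expo a (m - a)) (linPow m c d).1 = c ^ a * d ^ (m - a) * (m.choose a : k) := by
  rw [linPow_eq, coeff_sum, Finset.sum_eq_single a]
  · simp
  · intro b _ hb
    rw [coeff_monomial, if_neg]
    rw [expo_inj]; exact fun h => hb h.1
  · simp; omega

theorem choose_ne_zero (p : ℕ) [hp : Fact p.Prime] (k : Type u) [Field k] [CharP k p] {m : ℕ}
    (hm : m < p) {a : ℕ} (ha : a ≤ m) : (m.choose a : k) ≠ 0 := by
  rw [Ne, CharP.cast_eq_zero_iff k p]
  intro h
  have h2 : p ∣ m.factorial := by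
    rw [← Nat.choose_mul_factorial_mul_factorial ha, mul_assoc]
    exact Dvd.dvd.mul_right h _
  exact absurd ((hp.out.dvd_factorial).1 h2) (by omega)

theorem form_linPow (p : ℕ) [Fact p.Prime] {k : Type u} [Field k] [CharP k p] {m : ℕ}
    (hm : m < p) (v : V k m) (c d : k) :
    form k m v (linPow m c d) = eval ![-d, c] v.1 := by
  rw [form_apply, V_eval v.1 v.2]
  refine Finset.sum_congr rfl fun a ha => ?_
  have ha' : a ≤ m := by simpa [Nat.lt_succ_iff] using ha
  have h := coeff_linPow m c d (m - a) (Nat.sub_le m a)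
  rw [Nat.sub_sub_self ha', Nat.choose_symm ha'] at h
  rw [h]
  have := choose_ne_zero p k hm ha'
  field_simp
  simp
  rw [neg_pow d]
  ring

theorem substV_linPow {k : Type u} [Field k] (m : ℕ) (A : Matrix (Fin 2) (Fin 2) k) (c d : k) :
    substV m A (linPow m c d) =
      linPow m (c * A 0 0 + d * A 1 0) (c * A 0 1 + d * A 1 1) := by
  have h : subst A (C c * X 0 + C d * X 1) =
      C (c * A 0 0 + d * A 1 0) * X 0 + C (c * A 0 1 + d * A 1 1) * X 1 := by
    simp only [subst, map_add, map_mul, algHom_C, aeval_X, Fin.sum_univ_two, algebraMap_eq]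
    ring
  apply Subtype.ext
  exact (map_pow (subst A) _ m).trans (congrArg (fun f => f ^ m) h)

theorem eval_subst {k : Type u} [Field k] (A : Matrix (Fin 2) (Fin 2) k) (x : Fin 2 → k)
    (f : MvPolynomial (Fin 2) k) :
    eval x (subst A f) = eval (fun i => A i 0 * x 0 + A i 1 * x 1) f := by
  induction f using MvPolynomial.induction_on with
  | C a => simp [subst]
  | add f g hf hg => simp [hf, hg]
  | mul_X f i hf => rw [map_mul, map_mul, hf]; simp [subst, Fin.sum_univ_two]

theorem eval_smul_point {k : Type u} [Field k] {m : ℕ} (v : V k m) (x : Fin 2 → k) (r : k) :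
    eval (fun i => r * x i) v.1 = r ^ m * eval x v.1 := by
  rw [V_eval v.1 v.2, V_eval v.1 v.2, Finset.mul_sum]
  refine Finset.sum_congr rfl fun a ha => ?_
  have ha' : a ≤ m := by simpa [Nat.lt_succ_iff] using ha
  have : r ^ m = r ^ a * r ^ (m - a) := by rw [← pow_add, Nat.add_sub_cancel' ha']
  rw [this]; ring

/-- A linear functional on `V_m` that kills all `m`-th powers of linear forms is zero. -/
theorem functional_eq_zero (p : ℕ) [Fact p.Prime] {k : Type u} [Field k] [CharP k p] {m : ℕ}
    (hm : m < p) (f : V k m →ₗ[k] k) (hf : ∀ c d, f (linPow m c d) = 0) : f = 0 := by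
  classical
  let c : ℕ → k := fun a => if h : a ≤ m then f (mono k a h) else 0
  have key : ∀ w : V k m, f w = ∑ a ∈ Finset.range (m + 1), coeff (expo a (m - a)) w.1 * c a := by
    intro w
    have hw : w = ∑ a : Fin (m + 1),
        coeff (expo a (m - a)) w.1 • mono k a.1 (Nat.lt_succ_iff.1 a.2) := by
      apply Subtype.ext
      conv_lhs => rw [V_eq_sum w.1 w.2, Finset.sum_range]
      simp [mono, smul_monomial]
    conv_lhs => rw [hw]
    rw [map_sum, Finset.sum_range]
    refine Finset.sum_congr rfl fun a _ => ?_
    simp [c, Nat.lt_succ_iff.1 a.2]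
  let P : Polynomial k := ∑ a ∈ Finset.range (m + 1), Polynomial.C ((m.choose a : k) * c a) *
    Polynomial.X ^ a
  have hdeg : P.natDegree < m + 1 := by
    refine Nat.lt_succ_iff.2 (Polynomial.natDegree_sum_le_of_forall_le _ _ fun a ha => ?_)
    refine (Polynomial.natDegree_C_mul_X_pow_le _ _).trans ?_
    simpa [Nat.lt_succ_iff] using ha
  have hroot : ∀ t : k, P.eval t = 0 := by
    intro t
    have h := hf t 1
    rw [key] at h
    rw [← h, Polynomial.eval_finsetSum]
    refine Finset.sum_congr rfl fun a ha => ?_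
    rw [coeff_linPow m t 1 a (by simpa [Nat.lt_succ_iff] using ha)]
    simp; ring
  have hP : P = 0 := by
    refine Polynomial.eq_zero_of_natDegree_lt_card_of_eval_eq_zero P
      (f := fun i : Fin (m + 1) => ((i : ℕ) : k)) ?_ (fun i => hroot _) (by simpa using hdeg)
    intro i j hij
    apply Fin.ext
    have hij' : ((i : ℕ) : k) = ((j : ℕ) : k) := hij
    rw [CharP.natCast_eq_natCast k p] at hij'
    exact Nat.ModEq.eq_of_lt_of_lt hij' (by omega) (by omega)
  have hc : ∀ a, a ≤ m → c a = 0 := by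
    intro a ha
    have h : P.coeff a = (m.choose a : k) * c a := by
      simp only [P, Polynomial.finsetSum_coeff, Polynomial.coeff_C_mul_X_pow]
      rw [Finset.sum_ite_eq]
      simp [ha]
    rw [hP, Polynomial.coeff_zero] at h
    exact (mul_eq_zero.1 h.symm).resolve_left (choose_ne_zero p k hm ha)
  ext w
  rw [key w]
  exact Finset.sum_eq_zero fun a ha => by
    rw [hc a (by simpa [Nat.lt_succ_iff] using ha), mul_zero]

/-- `β (v · A) (w · A) = (det A) ^ m * β v w`. -/
theorem form_substV (p : ℕ) [Fact p.Prime] {k : Type u} [Field k] [CharP k p] {m : ℕ}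
    (hm : m < p) (A : Matrix (Fin 2) (Fin 2) k) (v w : V k m) :
    form k m (substV m A v) (substV m A w) = A.det ^ m * form k m v w := by
  have h := functional_eq_zero p hm
    ((form k m (substV m A v)).comp (substV m A) - A.det ^ m • form k m v) (by
      intro c d
      rw [LinearMap.sub_apply, LinearMap.comp_apply, LinearMap.smul_apply, substV_linPow,
        form_linPow p hm, form_linPow p hm, smul_eq_mul, ← eval_smul_point]
      change eval _ (subst A v.1) - _ = 0
      rw [eval_subst, sub_eq_zero]
      congr 2
      ext i
      fin_cases i <;> simp [Matrix.det_fin_two] <;> ring)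
  have h2 := LinearMap.congr_fun h w
  simpa [sub_eq_zero] using h2

/-- The right action of `(t, A) ∈ L` on `Q`: `(v, a) ↦ (t (v · A), t² (det A)^m a)`. -/
noncomputable def rightAct {k : Type u} [Field k] {m : ℕ} (l : L k) (q : Q k m) : Q k m :=
  ⟨(l.1 : k) • substV m l.2.1 q.vec, (l.1 : k) ^ 2 * l.2.1.det ^ m * q.cen⟩

theorem rightAct_mul {k : Type u} [Field k] {m : ℕ} (l l' : L k) (q : Q k m) :
    rightAct (l * l') q = rightAct l' (rightAct l q) := by
  apply Q.ext
  · apply Subtype.ext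
    change ((l.1 : k) * (l'.1 : k)) • subst (l.2.1 * l'.2.1) q.vec.1 =
      (l'.1 : k) • subst l'.2.1 ((l.1 : k) • subst l.2.1 q.vec.1)
    rw [subst_mul, map_smul, smul_smul, mul_comm]
  · change ((l.1 : k) * (l'.1 : k)) ^ 2 * (l.2.1 * l'.2.1).det ^ m * q.cen =
      (l'.1 : k) ^ 2 * l'.2.1.det ^ m * ((l.1 : k) ^ 2 * l.2.1.det ^ m * q.cen)
    rw [Matrix.det_mul]; ring

theorem rightAct_one {k : Type u} [Field k] {m : ℕ} (q : Q k m) :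
    rightAct (1 : L k) q = q := by
  apply Q.ext
  · apply Subtype.ext
    change (1 : k) • subst (1 : Matrix (Fin 2) (Fin 2) k) q.vec.1 = q.vec.1
    rw [subst_one, one_smul]
  · change (1 : k) ^ 2 * (1 : Matrix (Fin 2) (Fin 2) k).det ^ m * q.cen = q.cen
    simp

theorem rightAct_map_mul (p : ℕ) [Fact p.Prime] {k : Type u} [Field k] [CharP k p] {m : ℕ}
    (hm : m < p) (l : L k) (q r : Q k m) : rightAct l (q * r) = rightAct l q * rightAct l r := by
  apply Q.ext
  · change (l.1 : k) • substV m l.2.1 (q.vec + r.vec) =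
      (l.1 : k) • substV m l.2.1 q.vec + (l.1 : k) • substV m l.2.1 r.vec
    rw [map_add, smul_add]
  · change (l.1 : k) ^ 2 * l.2.1.det ^ m * (q.cen + r.cen + form k m q.vec r.vec) =
      (l.1 : k) ^ 2 * l.2.1.det ^ m * q.cen + (l.1 : k) ^ 2 * l.2.1.det ^ m * r.cen +
        form k m ((l.1 : k) • substV m l.2.1 q.vec) ((l.1 : k) • substV m l.2.1 r.vec)
    rw [map_smul, map_smul, LinearMap.smul_apply, form_substV p hm, smul_eq_mul, smul_eq_mul]
    ring

/-- The homomorphism `L → Aut Q` that describes the right action `q ↦ q ^ l`; as automorphisms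
are composed from right to left, `l` is sent to `q ↦ q ^ (l⁻¹)`. -/
noncomputable def actHom (p : ℕ) [Fact p.Prime] (k : Type u) [Field k] [CharP k p] (m : ℕ)
    [hm : Fact (m < p)] : L k →* MulAut (Q k m) where
  toFun l :=
    { toFun := rightAct l⁻¹
      invFun := rightAct l
      left_inv := fun q => by rw [← rightAct_mul, inv_mul_cancel, rightAct_one]
      right_inv := fun q => by rw [← rightAct_mul, mul_inv_cancel, rightAct_one]
      map_mul' := rightAct_map_mul p hm.out l⁻¹ }
  map_one' := by
    ext1 q
    change rightAct (1 : L k)⁻¹ q = q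
    rw [inv_one, rightAct_one]
  map_mul' l l' := by
    ext1 q
    change rightAct (l * l')⁻¹ q = rightAct l⁻¹ (rightAct l'⁻¹ q)
    rw [mul_inv_rev, rightAct_mul]

/-! ## The groups `P`, `P₁` and `S` -/

section

variable (p : ℕ) [Fact p.Prime] (k : Type u) [Field k] [CharP k p] (m : ℕ) [Fact (m < p)]

/-- `P = LQ`, the semidirect product; in it `l⁻¹ q l = q ^ l` for `l ∈ L` and `q ∈ Q`. -/
abbrev P : Type u := Q k m ⋊[actHom p k m] L k

/-- `C_L(Q)`, as a subgroup of `P`. -/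
noncomputable def centL : Subgroup (P p k m) :=
  (actHom p k m).ker.map SemidirectProduct.inr

instance centL_normal : (centL p k m).Normal where
  conj_mem := by
    rintro _ ⟨l, hl, rfl⟩ g
    refine ⟨g.right * l * g.right⁻¹, (actHom p k m).normal_ker.conj_mem l hl g.right, ?_⟩
    have hl' : actHom p k m l = 1 := hl
    ext1
    · simp [SemidirectProduct.mul_left, map_mul, hl']
    · simp

/-- `P₁ = P / C_L(Q)`. -/
abbrev P₁ : Type u := P p k m ⧸ centL p k m

/-- `S₀`: the elements `(1, A)` of `L` with `A` lower unitriangular. -/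
def S₀ : Subgroup (L k) where
  carrier := {l | l.1 = 1 ∧ l.2.1 0 0 = 1 ∧ l.2.1 0 1 = 0 ∧ l.2.1 1 1 = 1}
  one_mem' := by simp
  mul_mem' := by
    rintro l l' ⟨h1, h2, h3, h4⟩ ⟨h1', h2', h3', h4'⟩
    simp [Matrix.mul_apply, Fin.sum_univ_two, h1, h2, h3, h4, h1', h2', h3', h4']
  inv_mem' := by
    rintro l ⟨h1, h2, h3, h4⟩
    have hd : l.2.1.det = 1 := by rw [Matrix.det_fin_two, h2, h3, h4]; ring
    simp [Matrix.inv_def, Matrix.adjugate_fin_two, h1, h2, h3, h4, hd]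

/-- `S = S₀ Q`, as a subgroup of `P`. -/
noncomputable def S : Subgroup (P p k m) := (S₀ k).comap SemidirectProduct.rightHom

/-- The image of `S` in `P₁` (to which `S` is isomorphic, because `S ∩ C_L(Q) = 1`). -/
noncomputable def S₁ : Subgroup (P₁ p k m) := (S p k m).map (QuotientGroup.mk' (centL p k m))

end

/-! ## The groups `K` and `C` -/

/-- `K`: the elements of `SL₃(k)` with first row `(1, 0, 0)`. -/
def K (k : Type u) [Field k] : Subgroup (Matrix.SpecialLinearGroup (Fin 3) k) where
  carrier := {M | M.1 0 0 = 1 ∧ M.1 0 1 = 0 ∧ M.1 0 2 = 0}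
  one_mem' := by simp
  mul_mem' := by
    rintro M M' ⟨h1, h2, h3⟩ ⟨h1', h2', h3'⟩
    simp [Matrix.mul_apply, Fin.sum_univ_three, h1, h2, h3, h1', h2', h3']
  inv_mem' := by
    rintro M ⟨h1, h2, h3⟩
    have hd := M.2
    rw [Matrix.det_fin_three, h1, h2, h3] at hd
    simp [Matrix.SpecialLinearGroup.coe_inv, Matrix.adjugate_fin_three, h2, h3]
    linear_combination hd

/-- `C`: the elements of `SL₃(k)` of the form `!![1, 0, 0; α, θ, 0; δ, ε, θ⁻¹]`. (That the last
diagonal entry is `θ⁻¹` follows from the determinant being `1`.) -/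
def Cgp (k : Type u) [Field k] : Subgroup (Matrix.SpecialLinearGroup (Fin 3) k) where
  carrier := {M | (M.1 0 0 = 1 ∧ M.1 0 1 = 0 ∧ M.1 0 2 = 0) ∧ M.1 1 2 = 0}
  one_mem' := by simp
  mul_mem' := by
    rintro M M' ⟨h, h4⟩ ⟨h', h4'⟩
    refine ⟨(K k).mul_mem h h', ?_⟩
    simp [Matrix.mul_apply, Fin.sum_univ_three, h4, h4', h'.2.2]
  inv_mem' := by
    rintro M ⟨h, h4⟩
    refine ⟨(K k).inv_mem h, ?_⟩
    simp [Matrix.SpecialLinearGroup.coe_inv, Matrix.adjugate_fin_three, h.2.2, h4]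

theorem Cgp_le_K (k : Type u) [Field k] : Cgp k ≤ K k := fun _ h => h.1

/-! ## The amalgam and its fusion system -/

section

variable (p : ℕ) [Fact p.Prime] (k : Type u) [Field k] [CharP k p] (m : ℕ) [Fact (m < p)]

/-- The data for forming the amalgam: a subgroup `W₀` of `P₁` and an isomorphism from `C` to
`N_{P₁}(W₀)` under which `W = O_p(K)` corresponds to `W₀`. -/
structure AmalgamData where
  W₀ : Subgroup (P₁ p k m)
  iso : Cgp k ≃* Subgroup.normalizer (W₀ : Set (P₁ p k m))
  map_W : W₀ = (((normalPCore p (K k)).comap (Subgroup.inclusion (Cgp_le_K k))).map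
    iso.toMonoidHom).map (Subgroup.normalizer (W₀ : Set (P₁ p k m))).subtype

end

namespace AmalgamData

variable {p : ℕ} [Fact p.Prime] {k : Type u} [Field k] [CharP k p] {m : ℕ} [Fact (m < p)]

/-- The two groups that are amalgamated: `P₁` (index `true`) and `K` (index `false`). -/
abbrev fam (_D : AmalgamData p k m) : Bool → Type u
  | true => P₁ p k m
  | false => K k

noncomputable instance famGroup (D : AmalgamData p k m) : ∀ i, Group (D.fam i)
  | true => inferInstanceAs (Group (P₁ p k m))
  | false => inferInstanceAs (Group (K k))

/-- The embeddings of `C` into `P₁` (by the given isomorphism with `N_{P₁}(W₀)`) and into `K`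
(the inclusion). -/
noncomputable def emb (D : AmalgamData p k m) : ∀ i, Cgp k →* D.fam i
  | true => (Subgroup.normalizer (D.W₀ : Set (P₁ p k m))).subtype.comp D.iso.toMonoidHom
  | false => Subgroup.inclusion (Cgp_le_K k)

/-- The amalgamated product `G = P₁ *_C K`. -/
abbrev G (D : AmalgamData p k m) : Type u := Monoid.PushoutI D.emb

/-- `S` as a subgroup of `G`. -/
noncomputable def SG (D : AmalgamData p k m) : Subgroup D.G :=
  (S₁ p k m).map (Monoid.PushoutI.of (φ := D.emb) true)

/-- The Parker–Stroth fusion system `F_S(G)`. -/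
noncomputable def fusionSystem (D : AmalgamData p k m) : FusionSystem D.SG :=
  FusionSystem.ofGroup D.SG

end AmalgamData

end ParkerStroth

namespace ParkerStroth

open MvPolynomial

/-! ### The bilinear form on `V k m`, and `V k m` as a module for `GL (Fin 2) k` -/

section Vectors

variable {k : Type u} [Field k] {m : ℕ}

/-! Let `N` be a non-trivial strongly closed subgroup and `M` its preimage in `S ≤ P`. Commutators
with `Q` push `M` down: an element of `M` outside `Q` yields an element of `M ∩ Q` outside the
centre Z of `Q`, and this yields a non-trivial element of Z, because the form is non-degenerate. So
`M` always meets Z. Conversely, `L` acts transitively on the non-trivial elements of Z and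
irreducibly on `V k m`, and its diagonal matrices are transitive on the non-trivial elements of
`S₀`; hence `M = S` as soon as `M` is not contained in `Q` (`ClosedInP.eq_S`).

It remains to exclude `M ≤ Q`, and this is where `K` enters. Elements of order p centralise Z, so Z
normalises `W₀` and centralises it; since W is self-centralising in C, this gives Z ≤ `W₀`
(`central_mem_W₀`). All non-trivial elements of W are conjugate in `K`, so every non-trivial `w ∈
W₀` is conjugate in the amalgam to an element of `M ∩ Z`. Moreover `w` is conjugate in `P₁` into `S`
(`exists_conj_mem_S`), and that conjugate lies in `M ≤ Q`; as `Q` is normal, `w ∈ Q`.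

Thus `W₀ ≤ Q`, which is impossible (`not_W₀_le_Q`). Indeed `Q` would then normalise `W₀` and embed
in the unipotent part of C; comparing orders, m = 1 and `Q` is that whole unipotent part. But a
transvection of `V k 1` along a vector coming from `W₀` also normalises `W₀`, and it is a p-element
outside `Q`. -/

theorem V_ext {v w : V k m}
    (h : ∀ a ≤ m, coeff (expo a (m - a)) v.1 = coeff (expo a (m - a)) w.1) : v = w := by
  apply Subtype.ext
  rw [V_eq_sum v.1 v.2, V_eq_sum w.1 w.2]
  refine Finset.sum_congr rfl fun a ha => ?_
  rw [h a (by simpa [Nat.lt_succ_iff] using ha)]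

theorem coeff_mono (a b : ℕ) (ha : a ≤ m) :
    coeff (expo b (m - b)) (mono k a ha).1 = if a = b then 1 else 0 := by
  simp only [mono, coeff_monomial, expo_inj]
  by_cases h : a = b
  · simp [h]
  · simp [h]

/-- Replacing the index a by m - a exchanges the arguments, and the sign changes because m is odd.
-/
theorem form_antisymm (hm : Odd m) (v w : V k m) : form k m v w = -form k m w v := by
  rw [form_apply, form_apply, ← Finset.sum_range_reflect, ← Finset.sum_neg_distrib]
  refine Finset.sum_congr rfl fun a ha => ?_
  have ha' : a ≤ m := by simpa [Nat.lt_succ_iff] using ha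
  have h1 : m + 1 - 1 - a = m - a := by omega
  have h2 : ((-1 : k)) ^ (m - a) = -(-1) ^ a := by
    have h : (-1 : k) ^ (m - a) * (-1) ^ a = -1 := by
      rw [← pow_add, Nat.sub_add_cancel ha', hm.neg_one_pow]
    have h' : (-1 : k) ^ a * (-1) ^ a = 1 := by rw [← mul_pow]; simp
    linear_combination (-1 : k) ^ a * h - (-1) ^ (m - a) * h'
  rw [h1, h2, Nat.choose_symm ha', Nat.sub_sub_self ha']
  ring

/-- Pairing with the complementary monomial isolates one coefficient of `v`, up to a factor that is
non-zero because m < p. -/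
theorem exists_form_ne_zero (p : ℕ) [Fact p.Prime] [CharP k p] (hm : m < p) {v : V k m}
    (hv : v ≠ 0) : ∃ w, form k m v w ≠ 0 := by
  by_contra! h
  apply hv
  apply V_ext
  intro a ha
  have h1 := h (mono k (m - a) (Nat.sub_le m a))
  rw [form_apply, Finset.sum_eq_single a] at h1
  · have h3 := coeff_mono (k := k) (m - a) (m - a) (Nat.sub_le m a)
    rw [Nat.sub_sub_self ha, if_pos rfl] at h3
    rw [h3, mul_one] at h1
    refine (mul_eq_zero.1 h1).resolve_left (div_ne_zero ?_ (choose_ne_zero p k hm ha))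
    exact pow_ne_zero _ (by simp)
  · intro b hb hba
    have hb' : b ≤ m := by simpa [Nat.lt_succ_iff] using hb
    have h3 := coeff_mono (k := k) (m - a) (m - b) (Nat.sub_le m a)
    rw [Nat.sub_sub_self hb', if_neg (by omega)] at h3
    rw [h3, mul_zero]
  · intro h'; simp at h'; omega

theorem card_V [Finite k] : Nat.card (V k m) = Nat.card k ^ (m + 1) := by
  have e : V k m ≃ (Fin (m + 1) → k) := by
    refine Equiv.ofBijective (fun v a => coeff (expo a.1 (m - a.1)) v.1) ⟨?_, ?_⟩
    · intro v w h
      exact V_ext fun a ha => congrFun h ⟨a, Nat.lt_succ_iff.2 ha⟩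
    · intro f
      refine ⟨∑ a : Fin (m + 1), f a • mono k a.1 (Nat.lt_succ_iff.1 a.2), ?_⟩
      ext b
      simp only [Submodule.coe_sum, coeff_sum, Submodule.coe_smul, coeff_smul]
      rw [Finset.sum_eq_single b]
      · rw [coeff_mono]; simp
      · intro a _ hab
        rw [coeff_mono, if_neg (fun h => hab (Fin.ext h))]; simp
      · simp
  rw [Nat.card_congr e, Nat.card_fun]
  simp

theorem linPow_zero (hm : 1 ≤ m) : linPow m (0 : k) 0 = 0 := by
  apply Subtype.ext
  simp [linPow]
  omega

/-- A lower unitriangular substitution moves `y ^ m`. -/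
theorem substV_linPow_ne (p : ℕ) [Fact p.Prime] [CharP k p] (hm : m < p) (hm1 : 1 ≤ m)
    {A : Matrix (Fin 2) (Fin 2) k} (h10 : A 1 0 ≠ 0) (h11 : A 1 1 = 1) :
    substV m A (linPow m 0 1) ≠ linPow m 0 1 := by
  intro h
  rw [substV_linPow] at h
  have h1 := congrArg (fun v : V k m => coeff (expo 1 (m - 1)) v.1) h
  simp only [coeff_linPow m _ _ 1 hm1] at h1
  simp [h11] at h1
  have := choose_ne_zero p k hm hm1
  simp at this
  tauto

theorem polynomial_eq_C_of_forall_natCast (p : ℕ) [Fact p.Prime] [CharP k p] {P : Polynomial k}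
    (hP : P.natDegree < p) {c : k} (h : ∀ n : ℕ, P.eval (n : k) = c) : P = Polynomial.C c := by
  rw [← sub_eq_zero]
  refine Polynomial.eq_zero_of_natDegree_lt_card_of_eval_eq_zero _
    (f := fun i : Fin p => ((i : ℕ) : k)) ?_ (fun i => by simp [h]) ?_
  · intro i j hij
    apply Fin.ext
    have hij' : ((i : ℕ) : k) = ((j : ℕ) : k) := hij
    rw [CharP.natCast_eq_natCast k p] at hij'
    exact Nat.ModEq.eq_of_lt_of_lt hij' i.2 j.2
  · simpa using hP

/-- The vectors fixed by `y ↦ x + y` are the multiples of `x ^ m`. -/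
theorem eq_smul_linPow_of_fixed (p : ℕ) [Fact p.Prime] [CharP k p] (hm : m < p) {v : V k m}
    (hv : substV m !![1, 0; 1, 1] v = v) : ∃ c : k, v = c • linPow m 1 0 := by
  -- At x = 1 the vector becomes a polynomial in s of degree at most m < p that is invariant under s
  -- ↦ s + 1. It is constant on the prime field, hence constant, so only the coefficient of x^m
  -- survives.
  have hs : ∀ s : k, eval ![1, 1 + s] v.1 = eval ![1, s] v.1 := by
    intro s
    have h : subst !![1, 0; 1, 1] v.1 = v.1 := congrArg Subtype.val hv
    conv_rhs => rw [← h]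
    rw [eval_subst]
    congr 2
    ext i; fin_cases i <;> simp
  have hn : ∀ n : ℕ, eval ![1, (n : k)] v.1 = eval ![1, 0] v.1 := by
    intro n
    induction n with
    | zero => simp
    | succ n ih => rw [← ih, ← hs n]; push_cast; rw [add_comm]
  let P : Polynomial k := ∑ a ∈ Finset.range (m + 1),
    Polynomial.C (coeff (expo a (m - a)) v.1) * Polynomial.X ^ (m - a)
  have hdeg : P.natDegree < p := by
    refine lt_of_le_of_lt (Polynomial.natDegree_sum_le_of_forall_le _ _ fun a ha => ?_) hm
    exact (Polynomial.natDegree_C_mul_X_pow_le _ _).trans (Nat.sub_le _ _)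
  have hP := polynomial_eq_C_of_forall_natCast p hdeg (c := eval ![1, 0] v.1) (by
    intro n
    rw [← hn n, V_eval v.1 v.2, Polynomial.eval_finsetSum]
    simp)
  refine ⟨coeff (expo m 0) v.1, V_ext fun a ha => ?_⟩
  rw [Submodule.coe_smul, coeff_smul, coeff_linPow m _ _ a ha]
  rcases Nat.lt_or_ge a m with h | h
  · have hc : P.coeff (m - a) = coeff (expo a (m - a)) v.1 := by
      simp only [P, Polynomial.finsetSum_coeff, Polynomial.coeff_C_mul_X_pow]
      rw [Finset.sum_eq_single a]
      · simp
      · intro b hb hba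
        simp at hb
        rw [if_neg (by omega)]
      · simp; omega
    rw [← hc, hP, Polynomial.coeff_C, if_neg (by omega), zero_pow (by omega)]
    simp
  · obtain rfl : a = m := le_antisymm ha h
    simp

theorem substV_mul (A B : Matrix (Fin 2) (Fin 2) k) :
    substV m (A * B) = substV m B * substV m A := by
  ext1 v
  exact Subtype.ext (subst_mul A B v.1)

theorem substV_one : substV m (1 : Matrix (Fin 2) (Fin 2) k) = 1 := by
  ext1 v
  exact Subtype.ext (subst_one v.1)

theorem substV_pow (A : Matrix (Fin 2) (Fin 2) k) (n : ℕ) :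
    substV m (A ^ n) = substV m A ^ n := by
  induction n with
  | zero => simp [substV_one]
  | succ n ih => rw [pow_succ', substV_mul, ih, pow_succ]

theorem pow_char_eq_one {R : Type*} [Ring R] (p : ℕ) [Fact p.Prime] [CharP R p] {x : R}
    (hx : (x - 1) * (x - 1) = 0) : x ^ p = 1 := by
  have h := sub_pow_char_of_commute (p := p) (Commute.one_right x)
  rw [one_pow] at h
  have h2 : (x - 1) ^ p = 0 := by
    obtain ⟨n, hn⟩ := Nat.exists_eq_add_of_le (Nat.Prime.two_le (Fact.out : p.Prime))
    rw [hn, pow_add, pow_two, hx, zero_mul]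
  rw [h2] at h
  exact (sub_eq_zero.1 h.symm)

/-- In characteristic p, (f - 1)^p = f^p - 1 = 0; the last non-zero vector among the (f - 1)^n v is
fixed. -/
theorem exists_fixed_mem (p : ℕ) [Fact p.Prime] [CharP k p] {E : Type*} [AddCommGroup E]
    [Module k E] {f : Module.End k E} (hf : f ^ p = 1) {X : Submodule k E} (hX : ∀ v ∈ X, f v ∈ X)
    (h0 : X ≠ ⊥) : ∃ v ∈ X, v ≠ 0 ∧ f v = v := by
  classical
  obtain ⟨v, hv, hv0⟩ := X.ne_bot_iff.1 h0
  have : Nontrivial E := ⟨v, 0, hv0⟩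
  have : CharP (Module.End k E) p := charP_of_injective_algebraMap
    (FaithfulSMul.algebraMap_injective k (Module.End k E)) p
  have hn : (f - 1) ^ p = 0 := by
    rw [sub_pow_char_of_commute (p := p) (Commute.one_right f), hf, one_pow, sub_self]
  have hex : ∃ n, ((f - 1 : Module.End k E) ^ n) v = 0 := ⟨p, by rw [hn]; rfl⟩
  have hmem : ∀ n, ((f - 1 : Module.End k E) ^ n) v ∈ X := by
    intro n
    induction n with
    | zero => simpa using hv
    | succ n ih =>
      rw [pow_succ', Module.End.mul_apply]
      exact X.sub_mem (hX _ ih) ih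
  obtain ⟨n, hn1⟩ : ∃ n, Nat.find hex = n + 1 := by
    refine Nat.exists_eq_succ_of_ne_zero fun h => hv0 ?_
    have := Nat.find_spec hex
    rwa [h] at this
  refine ⟨_, hmem n, Nat.find_min hex (by omega), ?_⟩
  have h := Nat.find_spec hex
  rw [hn1, pow_succ', Module.End.mul_apply] at h
  exact sub_eq_zero.1 h

/-- `V_m` is an irreducible `GL₂(k)`-module. -/
theorem submodule_eq_top (p : ℕ) [Fact p.Prime] [CharP k p] (hm : m < p) (hm1 : 1 ≤ m)
    (X : Submodule k (V k m)) (hX : ∀ A : GL (Fin 2) k, ∀ v ∈ X, substV m A.1 v ∈ X)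
    (h0 : X ≠ ⊥) : X = ⊤ := by
  have hu : (!![1, 0; 1, 1] : Matrix (Fin 2) (Fin 2) k).det ≠ 0 := by
    simp [Matrix.det_fin_two]
  have hup : substV m (!![1, 0; 1, 1] : Matrix (Fin 2) (Fin 2) k) ^ p = 1 := by
    rw [← substV_pow, pow_char_eq_one p, substV_one]
    ext i j; fin_cases i <;> fin_cases j <;> simp [Matrix.mul_apply, Fin.sum_univ_two]
  obtain ⟨v, hv, hv0, hfix⟩ := exists_fixed_mem p hup
    (fun v hv => hX (Matrix.GeneralLinearGroup.mkOfDetNeZero _ hu) v hv) h0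
  obtain ⟨c, rfl⟩ := eq_smul_linPow_of_fixed p hm hfix
  have hc : c ≠ 0 := fun h => hv0 (by simp [h])
  have hx : linPow m 1 0 ∈ X := by
    have := X.smul_mem c⁻¹ hv
    rwa [smul_smul, inv_mul_cancel₀ hc, one_smul] at this
  -- Any non-zero linear form is the image of x under an invertible substitution. The powers
  -- obtained in this way span, since no non-zero functional kills them all.
  have hlin : ∀ c d : k, linPow m c d ∈ X := by
    intro c d
    have key : ∀ A : Matrix (Fin 2) (Fin 2) k, A.det ≠ 0 → linPow m (A 0 0) (A 0 1) ∈ X := by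
      intro A hA
      have := hX (Matrix.GeneralLinearGroup.mkOfDetNeZero A hA) _ hx
      rw [substV_linPow] at this
      simpa [Matrix.GeneralLinearGroup.mkOfDetNeZero] using this
    by_cases hc : c = 0
    · by_cases hd : d = 0
      · rw [hc, hd, linPow_zero hm1]; exact X.zero_mem
      · simpa using key !![c, d; 1, 0] (by simpa [Matrix.det_fin_two] using hd)
    · simpa using key !![c, d; 0, 1] (by simpa [Matrix.det_fin_two] using hc)
  by_contra hne
  obtain ⟨f, hf0, hf⟩ := Submodule.exists_le_ker_of_lt_top X (lt_top_iff_ne_top.2 hne)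
  exact hf0 (functional_eq_zero p hm f fun c d => hf (hlin c d))

/-- The elements of `kˣ × GL₂(k)` that act trivially on `V_m` are scalar. -/
theorem scalar_of_smul_substV_eq (p : ℕ) [Fact p.Prime] [CharP k p] (hm : m < p) (hm1 : 1 ≤ m)
    {t : k} {A : Matrix (Fin 2) (Fin 2) k} (h : ∀ v : V k m, t • substV m A v = v) :
    A 0 1 = 0 ∧ A 1 0 = 0 ∧ A 1 1 = A 0 0 ∧ t * A 0 0 ^ m = 1 := by
  have key : ∀ c d : k, ∀ a ≤ m, t * ((c * A 0 0 + d * A 1 0) ^ a *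
      (c * A 0 1 + d * A 1 1) ^ (m - a)) = c ^ a * d ^ (m - a) := by
    intro c d a ha
    have h1 := congrArg (fun v : V k m => coeff (expo a (m - a)) v.1) (h (linPow m c d))
    simp only [substV_linPow, Submodule.coe_smul, coeff_smul, coeff_linPow m _ _ a ha,
      smul_eq_mul] at h1
    rw [← mul_assoc] at h1
    exact mul_right_cancel₀ (choose_ne_zero p k hm ha) h1
  -- The two leading coefficients of the images of x^m and of y^m force the matrix to be diagonal;
  -- the image of (x + y)^m then compares the diagonal entries.
  have h1 := key 1 0 m le_rfl
  have h2 := key 1 0 (m - 1) (Nat.sub_le _ _)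
  have h3 := key 0 1 0 (Nat.zero_le _)
  have h4 := key 0 1 1 hm1
  simp only [Nat.sub_sub_self hm1, one_mul, zero_mul, add_zero, one_pow, pow_one, mul_one, mul_zero,
    Nat.sub_self, pow_zero, Nat.sub_zero, zero_add] at h1 h2 h3 h4
  have hA0 : A 0 0 ≠ 0 := by
    intro h; rw [h, zero_pow (by omega)] at h1; simp at h1
  have hA1 : A 1 1 ≠ 0 := by
    intro h; rw [h, zero_pow (by omega)] at h3; simp at h3
  have ht : t ≠ 0 := by
    intro h; simp [h] at h1
  have h01 : A 0 1 = 0 := by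
    simpa [ht, hA0] using h2
  have h10 : A 1 0 = 0 := by
    simpa [ht, hA1] using h4
  refine ⟨h01, h10, ?_, h1⟩
  have h5 := key 1 1 m le_rfl
  have h6 := key 1 1 (m - 1) (Nat.sub_le _ _)
  simp only [Nat.sub_sub_self hm1, h01, h10, one_mul, add_zero, zero_add, one_pow, pow_one,
    Nat.sub_self, pow_zero, mul_one] at h5 h6
  obtain ⟨n, rfl⟩ := Nat.exists_eq_add_of_le' hm1
  rw [Nat.add_sub_cancel] at h6
  rw [pow_succ] at h5
  have h7 : t * A 0 0 ^ n ≠ 0 := mul_ne_zero ht (pow_ne_zero _ hA0)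
  refine mul_left_cancel₀ h7 ?_
  linear_combination h6 - h5

/-- The symplectic transvections of `V_1` are induced by elements of `GL₂(k)` of order `p`. -/
theorem exists_transvection (p : ℕ) [hp : Fact p.Prime] [CharP k p] (u : V k 1) :
    ∃ A : GL (Fin 2) k, A ^ p = 1 ∧ ∀ v, substV 1 A.1 v = v + form k 1 v u • u := by
  have hlin : ∀ v : V k 1, ∃ a b, v = linPow 1 a b := by
    intro v
    refine ⟨coeff (expo 1 0) v.1, coeff (expo 0 1) v.1, V_ext fun a ha => ?_⟩
    rw [coeff_linPow _ _ _ a ha]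
    interval_cases a <;> simp
  obtain ⟨a, b, rfl⟩ := hlin u
  -- For u = a x + b y the form sends x to -b and y to a against u, so the transvection maps x to x
  -- - b u and y to y + a u. Its matrix minus 1 has square zero, which makes its order divide p.
  have hdet : (!![1 - a * b, -b ^ 2; a ^ 2, 1 + a * b] : Matrix (Fin 2) (Fin 2) k).det ≠ 0 := by
    rw [Matrix.det_fin_two_of, show (1 - a * b) * (1 + a * b) - -b ^ 2 * a ^ 2 = 1 by ring]
    exact one_ne_zero
  refine ⟨Matrix.GeneralLinearGroup.mkOfDetNeZero _ hdet, ?_, fun v => ?_⟩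
  · apply Units.ext
    rw [Units.val_pow_eq_pow_val]
    apply pow_char_eq_one p
    ext i j
    fin_cases i <;> fin_cases j <;>
      simp [Matrix.GeneralLinearGroup.mkOfDetNeZero, Matrix.mul_apply, Fin.sum_univ_two] <;> ring
  · obtain ⟨c, d, rfl⟩ := hlin v
    rw [substV_linPow, form_linPow p hp.out.one_lt]
    apply Subtype.ext
    simp only [linPow, Matrix.GeneralLinearGroup.mkOfDetNeZero, pow_one, Submodule.coe_add,
      Submodule.coe_smul, smul_eq_C_mul]
    simp
    ring

end Vectors

end ParkerStroth
namespace ParkerStroth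

/-! ### Matrix computations in `K`, W and C, and p-elements of `GL (Fin 2) k` -/

section Matrices

variable {k : Type u} [Field k]

theorem K_ext {M N : K k}
    (h10 : M.1.1 1 0 = N.1.1 1 0) (h11 : M.1.1 1 1 = N.1.1 1 1) (h12 : M.1.1 1 2 = N.1.1 1 2)
    (h20 : M.1.1 2 0 = N.1.1 2 0) (h21 : M.1.1 2 1 = N.1.1 2 1) (h22 : M.1.1 2 2 = N.1.1 2 2) :
    M = N := by
  obtain ⟨a, b, c⟩ := M.2
  obtain ⟨a', b', c'⟩ := N.2
  apply Subtype.ext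
  apply Subtype.ext
  ext i j
  fin_cases i <;> fin_cases j <;> simp [*]

theorem Cgp_ext {M N : Cgp k}
    (h10 : M.1.1 1 0 = N.1.1 1 0) (h11 : M.1.1 1 1 = N.1.1 1 1)
    (h20 : M.1.1 2 0 = N.1.1 2 0) (h21 : M.1.1 2 1 = N.1.1 2 1) (h22 : M.1.1 2 2 = N.1.1 2 2) :
    M = N :=
  Subgroup.inclusion_injective (Cgp_le_K k)
    (K_ext h10 h11 (M.2.2.trans N.2.2.symm) h20 h21 h22)

theorem K_det {M : Matrix.SpecialLinearGroup (Fin 3) k} (hM : M ∈ K k) :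
    M.1 1 1 * M.1 2 2 - M.1 1 2 * M.1 2 1 = 1 := by
  have h := M.2
  rw [Matrix.det_fin_three, hM.1, hM.2.1, hM.2.2] at h
  linear_combination h

/-- The element of `K` with diagonal block `!![a, b; c, d]` and first column `(1, r, s)`. -/
def kMat (r s a b c d : k) (h : a * d - b * c = 1) : K k :=
  ⟨⟨!![1, 0, 0; r, a, b; s, c, d], by
    rw [Matrix.det_fin_three]; simp; linear_combination h⟩, rfl, rfl, rfl⟩

/-- The element of `C` with diagonal `(1, a, d)`, where `a * d = 1`. -/
def cMat (r s a c d : k) (h : a * d = 1) : Cgp k :=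
  ⟨⟨!![1, 0, 0; r, a, 0; s, c, d], by
    rw [Matrix.det_fin_three]; simp; linear_combination h⟩, ⟨rfl, rfl, rfl⟩, rfl⟩

theorem coe_kMat (r s a b c d : k) (h : a * d - b * c = 1) :
    (kMat r s a b c d h).1.1 = !![1, 0, 0; r, a, b; s, c, d] := rfl

theorem coe_cMat (r s a c d : k) (h : a * d = 1) :
    (cMat r s a c d h).1.1 = !![1, 0, 0; r, a, 0; s, c, d] := rfl

theorem K_coe_mul (M N : K k) : (M * N).1.1 = M.1.1 * N.1.1 := rfl

theorem K_coe_inv (M : K k) : (M⁻¹).1.1 = M.1.1.adjugate := rfl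

theorem Cgp_coe_mul (M N : Cgp k) : (M * N).1.1 = M.1.1 * N.1.1 := rfl

theorem Cgp_coe_inv (M : Cgp k) : (M⁻¹).1.1 = M.1.1.adjugate := rfl

/-- A p-element is unipotent: M - 1 is nilpotent and so has trace 0. -/
theorem trace_eq_three (p : ℕ) [Fact p.Prime] [CharP k p] {M : Matrix.SpecialLinearGroup (Fin 3) k}
    {j : ℕ} (hM : M ^ p ^ j = 1) : M.1 0 0 + M.1 1 1 + M.1 2 2 = 3 := by
  have h1 : M.1 ^ p ^ j = 1 := by
    have := congrArg Subtype.val hM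
    simpa using this
  have h2 : (M.1 - 1) ^ p ^ j = 0 := by
    rw [sub_pow_char_pow_of_commute (p := p) _ (Commute.one_right M.1), h1, one_pow, sub_self]
  have h3 := (Matrix.isNilpotent_trace_of_isNilpotent ⟨_, h2⟩).eq_zero
  simp only [Matrix.trace_fin_three, Matrix.sub_apply, Matrix.one_apply_eq] at h3
  linear_combination h3

/-- The subgroup `W` of `K`. -/
def wGroup (k : Type u) [Field k] : Subgroup (K k) where
  carrier := {M | M.1.1 1 1 = 1 ∧ M.1.1 1 2 = 0 ∧ M.1.1 2 1 = 0 ∧ M.1.1 2 2 = 1}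
  one_mem' := by simp
  mul_mem' := by
    rintro ⟨M, hM⟩ ⟨N, hN⟩ ⟨h1, h2, h3, h4⟩ ⟨h1', h2', h3', h4'⟩
    obtain ⟨a, b, c⟩ := hN
    dsimp only at *
    simp [Matrix.mul_apply, Fin.sum_univ_three, *]
  inv_mem' := by
    rintro ⟨M, hM⟩ ⟨h1, h2, h3, h4⟩
    obtain ⟨a, b, c⟩ := hM
    dsimp only at *
    simp [Matrix.SpecialLinearGroup.coe_inv, Matrix.adjugate_fin_three, *]

theorem mem_wGroup {M : K k} : M ∈ wGroup k ↔
    M.1.1 1 1 = 1 ∧ M.1.1 1 2 = 0 ∧ M.1.1 2 1 = 0 ∧ M.1.1 2 2 = 1 := Iff.rfl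

instance wGroup_normal : (wGroup k).Normal where
  conj_mem := by
    rintro M ⟨h1, h2, h3, h4⟩ N
    have hd := K_det N.2
    obtain ⟨a, b, c⟩ := M.2
    obtain ⟨a', b', c'⟩ := N.2
    simp only [mem_wGroup, K_coe_mul, K_coe_inv, Matrix.adjugate_fin_three, Matrix.mul_apply,
      Fin.sum_univ_three]
    simp [*]
    exact ⟨by linear_combination hd, by ring, by ring, by linear_combination hd⟩

theorem wGroup_pow {M : K k} (hM : M ∈ wGroup k) (n : ℕ) :
    (M ^ n).1.1 1 0 = n * M.1.1 1 0 ∧ (M ^ n).1.1 2 0 = n * M.1.1 2 0 := by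
  induction n with
  | zero => simp
  | succ n ih =>
    obtain ⟨h1, h2, h3, h4⟩ := (wGroup k).pow_mem hM n
    have h5 := M.2.1
    rw [pow_succ]
    simp only [Subgroup.coe_mul, Matrix.SpecialLinearGroup.coe_mul, Matrix.mul_apply,
      Fin.sum_univ_three]
    rw [ih.1, ih.2, h1, h2, h3, h4, h5]
    push_cast
    constructor <;> ring

theorem wGroup_pow_char (p : ℕ) [CharP k p] {M : K k} (hM : M ∈ wGroup k) : M ^ p = 1 := by
  have h := wGroup_pow hM p
  obtain ⟨h1, h2, h3, h4⟩ := (wGroup k).pow_mem hM p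
  simp only [CharP.cast_eq_zero, zero_mul] at h
  exact K_ext (M := M ^ p) (N := 1) h.1 h1 h2 h.2 h3 h4

theorem isPGroup_wGroup (p : ℕ) [CharP k p] : IsPGroup p (wGroup k) := by
  rintro ⟨M, hM⟩
  refine ⟨1, Subtype.ext ?_⟩
  rw [pow_one]
  exact wGroup_pow_char p hM

/-- If `n` and `n * (u n u⁻¹)` are unipotent for the elementary matrices `u`, then the diagonal
block of `n` is trivial. -/
theorem mem_wGroup_of_trace {M : K k}
    (h1 : ∀ u : K k, (M * (u * M * u⁻¹)).1.1 0 0 + (M * (u * M * u⁻¹)).1.1 1 1 +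
      (M * (u * M * u⁻¹)).1.1 2 2 = 3)
    (h0 : M.1.1 0 0 + M.1.1 1 1 + M.1.1 2 2 = 3) : M ∈ wGroup k := by
  -- The diagonal block B has trace 2 and determinant 1, so for an elementary u the trace of
  -- B(uBu⁻¹) is 2 minus the square of an off-diagonal entry of B.
  have hu := h1 (kMat 0 0 1 1 0 1 (by ring))
  have hl := h1 (kMat 0 0 1 0 1 1 (by ring))
  have hd := K_det M.2
  obtain ⟨a, b, c⟩ := M.2
  simp only [K_coe_mul, K_coe_inv, coe_kMat, Matrix.adjugate_fin_three, Matrix.mul_apply,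
    Fin.sum_univ_three] at hu hl
  simp [a, b, c] at hu hl
  rw [a] at h0
  have e : M.1.1 2 2 = 2 - M.1.1 1 1 := by linear_combination h0
  rw [e] at hu hl hd
  have h21 : M.1.1 2 1 = 0 := by
    have : M.1.1 2 1 ^ 2 = 0 := by linear_combination -hu - 2 * hd
    simpa using this
  have h12 : M.1.1 1 2 = 0 := by
    have : M.1.1 1 2 ^ 2 = 0 := by linear_combination -hl - 2 * hd
    simpa using this
  have h11 : M.1.1 1 1 = 1 := by
    have : (M.1.1 1 1 - 1) ^ 2 = 0 := by
      rw [h21, h12] at hd; linear_combination -hd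
    exact sub_eq_zero.1 (by simpa using this)
  refine ⟨h11, h12, h21, ?_⟩
  rw [e, h11]; ring

/-- In a normal p-subgroup, each element and its products with its own conjugates are unipotent, so
the trace criterion applies. -/
theorem normalPCore_K (p : ℕ) [Fact p.Prime] [CharP k p] : normalPCore p (K k) = wGroup k := by
  apply le_antisymm
  · refine sSup_le ?_
    rintro N ⟨hN, hp⟩ M hM
    have key : ∀ M ∈ N, M.1.1 0 0 + M.1.1 1 1 + M.1.1 2 2 = 3 := by
      intro M hM
      obtain ⟨j, hj⟩ := hp ⟨M, hM⟩
      have hj' : M ^ p ^ j = 1 := congrArg Subtype.val hj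
      exact trace_eq_three p (j := j) (by simpa using congrArg Subtype.val hj')
    exact mem_wGroup_of_trace (fun u => key _ (N.mul_mem hM (hN.conj_mem M hM u))) (key M hM)
  · exact le_sSup ⟨wGroup_normal, isPGroup_wGroup p⟩

/-- W is the natural column module for the diagonal block SL₂: a non-zero column can be completed to
a matrix of determinant 1, which carries the first basis vector to it. -/
theorem exists_conj_eq {M : K k} (hM : M ∈ wGroup k) (h1 : M ≠ 1) :
    ∃ κ : K k, κ * kMat 1 0 1 0 0 1 (by ring) * κ⁻¹ = M := by
  obtain ⟨e11, e12, e21, e22⟩ := hM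
  have hK := M.2
  obtain ⟨a, b, c⟩ := hK
  have key : ∀ x y (hd : M.1.1 1 0 * y - x * M.1.1 2 0 = 1),
      ∃ κ : K k, κ * kMat 1 0 1 0 0 1 (by ring) * κ⁻¹ = M := by
    intro x y hd
    refine ⟨kMat 0 0 (M.1.1 1 0) x (M.1.1 2 0) y hd, ?_⟩
    rw [mul_inv_eq_iff_eq_mul]
    refine K_ext ?_ ?_ ?_ ?_ ?_ ?_ <;>
      simp only [K_coe_mul, coe_kMat, Matrix.mul_apply, Fin.sum_univ_three] <;> simp [*]
  by_cases h0 : M.1.1 1 0 = 0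
  · by_cases h0' : M.1.1 2 0 = 0
    · refine absurd (K_ext ?_ ?_ ?_ ?_ ?_ ?_) h1 <;> simp [*]
    · exact key (-(M.1.1 2 0)⁻¹) 0 (by simp [*])
  · exact key 0 (M.1.1 1 0)⁻¹ (by simp [*])

/-- `K` is transitive on the non-trivial elements of `W`. -/
theorem isConj_of_mem_wGroup {M N : K k} (hM : M ∈ wGroup k) (h1 : M ≠ 1)
    (hN : N ∈ wGroup k) (h2 : N ≠ 1) : IsConj M N := by
  have h3 := isConj_iff.2 (exists_conj_eq hM h1)
  have h4 := isConj_iff.2 (exists_conj_eq hN h2)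
  exact h3.symm.trans h4

/-! ### The subgroup `C` -/

theorem Cgp_pow_apply (M : Cgp k) (n : ℕ) : (M ^ n).1.1 1 1 = M.1.1 1 1 ^ n := by
  induction n with
  | zero => simp
  | succ n ih =>
    have h1 := M.2.1.2.1
    have h2 := (M ^ n).2.2
    rw [pow_succ, pow_succ]
    simp only [Subgroup.coe_mul, Matrix.SpecialLinearGroup.coe_mul, Matrix.mul_apply,
      Fin.sum_univ_three]
    rw [h1, h2, ih]
    ring

theorem eq_one_of_pow_char_pow (p : ℕ) [Fact p.Prime] [CharP k p] {x : k} {j : ℕ}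
    (h : x ^ p ^ j = 1) : x = 1 := by
  have h2 := sub_pow_char_pow (p := p) (n := j) x 1
  rw [h, one_pow, sub_self] at h2
  exact sub_eq_zero.1 (eq_zero_of_pow_eq_zero h2)

/-- The entry θ is multiplicative on C, and the multiplicative group of k has no p-torsion. -/
theorem Cgp_diag_eq_one (p : ℕ) [Fact p.Prime] [CharP k p] {M : Cgp k} {j : ℕ}
    (h : M ^ p ^ j = 1) : M.1.1 1 1 = 1 := by
  apply eq_one_of_pow_char_pow p (j := j)
  rw [← Cgp_pow_apply, h]; simp

theorem Cgp_last_eq_one {M : Cgp k} (h : M.1.1 1 1 = 1) : M.1.1 2 2 = 1 := by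
  have := K_det M.2.1
  rw [h, M.2.2] at this
  linear_combination this

/-- Commuting with this single element of W already forces θ = 1 and ε = 0; in particular W contains
its centraliser in C. -/
theorem mem_wGroup_of_commute {M : Cgp k}
    (h : Commute M (cMat 1 0 1 0 1 (by ring))) :
    Subgroup.inclusion (Cgp_le_K k) M ∈ wGroup k := by
  obtain ⟨⟨a, b, c⟩, d⟩ := M.2
  have h' : M.1.1 * (cMat (1 : k) 0 1 0 1 (by ring)).1.1 =
      (cMat (1 : k) 0 1 0 1 (by ring)).1.1 * M.1.1 := congrArg (fun x : Cgp k => x.1.1) h.eq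
  have h1 := congrFun (congrFun h' 1) 0
  have h2 := congrFun (congrFun h' 2) 0
  simp [cMat, Matrix.mul_apply, Fin.sum_univ_three, a] at h1 h2
  have h3 : M.1.1 1 1 = 1 := by linear_combination h1
  exact ⟨h3, d, h2, Cgp_last_eq_one h3⟩

theorem not_commute_cMat :
    ¬ Commute (cMat (0 : k) 0 1 1 1 (by ring)) (cMat 1 0 1 0 1 (by ring)) := by
  intro h
  have := mem_wGroup_of_commute h
  simpa [cMat] using this.2.2.1

theorem cMat_pow_char (p : ℕ) [hp : Fact p.Prime] [CharP k p] :
    cMat (0 : k) 0 1 1 1 (by ring) ^ p = 1 := by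
  apply Subtype.ext
  apply Subtype.ext
  simp only [Subgroup.coe_pow, cMat]
  refine (pow_char_eq_one p ?_).trans (by simp)
  ext i j
  fin_cases i <;> fin_cases j <;> simp [Matrix.mul_apply, Fin.sum_univ_three]

theorem card_Cgp_unipotent_le [Finite k] :
    Nat.card {M : Cgp k // M.1.1 1 1 = 1} ≤ Nat.card k ^ 3 := by
  have := Nat.card_le_card_of_injective
    (fun M : {M : Cgp k // M.1.1 1 1 = 1} => ![M.1.1.1 1 0, M.1.1.1 2 0, M.1.1.1 2 1]) (by
      rintro ⟨M, hM⟩ ⟨N, hN⟩ h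
      have h0 := congrFun h 0
      have h1 := congrFun h 1
      have h2 := congrFun h 2
      simp at h0 h1 h2
      refine Subtype.ext (Cgp_ext h0 (hM.trans hN.symm) h1 h2 ?_)
      exact (Cgp_last_eq_one hM).trans (Cgp_last_eq_one hN).symm)
  simpa [Nat.card_fun] using this

/-- The involution `diag(1, -1, -1)`. -/
def hMat (k : Type u) [Field k] : Cgp k := cMat 0 0 (-1) 0 (-1) (by ring)

theorem hMat_mul_self : hMat k * hMat k = 1 := by
  refine Cgp_ext ?_ ?_ ?_ ?_ ?_ <;>
    simp only [Cgp_coe_mul, hMat, coe_cMat, Matrix.mul_apply, Fin.sum_univ_three] <;> simp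

/-- The diagonal block of `hMat k` is the scalar -1, so it commutes with the block of `M` and the
commutator has trivial block. On W itself the same scalar acts as inversion. -/
theorem hMat_comm_mem {M : Cgp k} (hM : M.1.1 1 1 = 1) :
    Subgroup.inclusion (Cgp_le_K k) (hMat k * M * (hMat k)⁻¹ * M⁻¹) ∈ wGroup k := by
  have h2 := Cgp_last_eq_one hM
  obtain ⟨⟨a, b, c⟩, d⟩ := M.2
  rw [inv_eq_of_mul_eq_one_left hMat_mul_self, mem_wGroup]
  simp only [Subgroup.coe_inclusion, Cgp_coe_mul, Cgp_coe_inv, hMat, coe_cMat,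
    Matrix.adjugate_fin_three, Matrix.mul_apply, Fin.sum_univ_three]
  simp [*]

theorem hMat_conj_eq_inv {M : Cgp k} (hM : Subgroup.inclusion (Cgp_le_K k) M ∈ wGroup k) :
    hMat k * M * (hMat k)⁻¹ * M = 1 := by
  obtain ⟨⟨a, b, c⟩, d⟩ := M.2
  obtain ⟨e1, e2, e3, e4⟩ := hM
  simp only [Subgroup.coe_inclusion] at e1 e2 e3 e4
  rw [inv_eq_of_mul_eq_one_left hMat_mul_self]
  refine Cgp_ext ?_ ?_ ?_ ?_ ?_ <;>
    simp only [Cgp_coe_mul, hMat, coe_cMat, Matrix.mul_apply, Fin.sum_univ_three] <;> simp [*]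

/-! ### Unipotent elements of `GL₂(k)` -/

/-- A `2 × 2` matrix with `A ^ (p ^ j)` scalar is conjugate to a lower triangular matrix with equal
diagonal entries. -/
theorem exists_conj_lower (p : ℕ) [Fact p.Prime] [CharP k p] {A : GL (Fin 2) k} {j : ℕ} {b : k}
    (h : A.1 ^ p ^ j = Matrix.scalar (Fin 2) (b ^ p ^ j)) :
    ∃ g : GL (Fin 2) k, (g * A * g⁻¹).1 0 1 = 0 ∧ (g * A * g⁻¹).1 0 0 = b ∧
      (g * A * g⁻¹).1 1 1 = b := by
  have h2 : (A.1 - Matrix.scalar (Fin 2) b) ^ p ^ j = 0 := by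
    rw [sub_pow_char_pow_of_commute (p := p) _ (Matrix.scalar_commute b (Commute.all b) A.1).symm, h,
      map_pow, sub_self]
  have h3 := (Matrix.isNilpotent_trace_of_isNilpotent ⟨_, h2⟩).eq_zero
  have h4 : (A.1 - Matrix.scalar (Fin 2) b).det = 0 := by
    have := congrArg Matrix.det h2
    rw [Matrix.det_pow, Matrix.det_zero] at this
    exact eq_zero_of_pow_eq_zero this
  rw [Matrix.det_fin_two] at h4
  simp [Matrix.trace_fin_two] at h3 h4
  by_cases h01 : A.1 0 1 = 0
  · refine ⟨1, ?_⟩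
    rw [h01, zero_mul, sub_zero] at h4
    have e : A.1 1 1 - b = -(A.1 0 0 - b) := by linear_combination h3
    rw [e, mul_neg, neg_eq_zero, mul_self_eq_zero] at h4
    rw [h4, neg_zero] at e
    simp [h01, sub_eq_zero.1 h4, sub_eq_zero.1 e]
  -- The rows are e(A - b) and e, with e the first unit row vector: a Jordan basis for the action on
  -- row vectors.
  · have hdet : (!![A.1 0 0 - b, A.1 0 1; 1, 0] : Matrix (Fin 2) (Fin 2) k).det ≠ 0 := by
      simpa [Matrix.det_fin_two] using h01
    refine ⟨Matrix.GeneralLinearGroup.mkOfDetNeZero _ hdet, ?_⟩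
    set g := Matrix.GeneralLinearGroup.mkOfDetNeZero _ hdet with hg
    have hm : (g * A).1 = !![b, 0; 1, b] * g.1 := by
      ext i l
      fin_cases i <;> fin_cases l <;>
        simp [hg, Matrix.GeneralLinearGroup.mkOfDetNeZero, Matrix.mul_apply, Fin.sum_univ_two]
      · linear_combination (A.1 0 0 - b) * h3 - h4
      · linear_combination A.1 0 1 * h3
    have hm' : (g * A * g⁻¹).1 = !![b, 0; 1, b] := by
      rw [Units.val_mul, hm, mul_assoc, Units.mul_inv, mul_one]
    rw [hm']
    simp

end Matrices

end ParkerStroth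
namespace ParkerStroth

open MvPolynomial SemidirectProduct

/-! ### Conjugation formulas in `Q` and `P` -/

section Conjugation

variable {p : ℕ} [Fact p.Prime] {k : Type u} [Field k] [CharP k p] {m : ℕ} [hm : Fact (m < p)]

namespace Q

theorem one_vec : (1 : Q k m).vec = 0 := rfl

theorem one_cen : (1 : Q k m).cen = 0 := rfl

theorem inv_vec (q : Q k m) : q⁻¹.vec = -q.vec := rfl

theorem inv_cen (q : Q k m) : q⁻¹.cen = -q.cen + form k m q.vec q.vec := rfl

theorem conj_eq (q r : Q k m) :
    q * r * q⁻¹ = ⟨r.vec, r.cen + form k m q.vec r.vec - form k m r.vec q.vec⟩ := by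
  apply Q.ext
  · simp only [mul_vec, inv_vec]; abel
  · simp only [mul_vec, inv_vec, mul_cen, inv_cen, map_neg, map_add, LinearMap.add_apply]
    ring

theorem pow_vec (q : Q k m) (n : ℕ) : (q ^ n).vec = (n : k) • q.vec := by
  induction n with
  | zero => simp [one_vec]
  | succ n ih => rw [pow_succ, mul_vec, ih]; push_cast; rw [add_smul, one_smul]

theorem pow_cen_of_vec_eq_zero {q : Q k m} (hq : q.vec = 0) (n : ℕ) : (q ^ n).cen = n * q.cen := by
  induction n with
  | zero => simp [one_cen]
  | succ n ih => rw [pow_succ, mul_cen, ih, hq]; push_cast; simp; ring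

theorem pow_char_sq (p : ℕ) [CharP k p] (q : Q k m) : q ^ p ^ 2 = 1 := by
  have h : (q ^ p).vec = 0 := by rw [pow_vec]; simp
  rw [pow_two, pow_mul]
  apply Q.ext
  · rw [pow_vec, h]; simp [one_vec]
  · rw [pow_cen_of_vec_eq_zero h]; simp [one_cen]

theorem card [Finite k] : Nat.card (Q k m) = Nat.card k ^ (m + 2) := by
  have e : Q k m ≃ V k m × k :=
    ⟨fun q => (q.vec, q.cen), fun x => ⟨x.1, x.2⟩, fun _ => rfl, fun _ => rfl⟩
  rw [Nat.card_congr e, Nat.card_prod, card_V, ← pow_succ]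

end Q

/-- The linear action of `L` on `V_m` through which `L` acts on `Q` from the left. -/
noncomputable def linAct (m : ℕ) (l : L k) : V k m →ₗ[k] V k m :=
  (l⁻¹.1 : k) • substV m l⁻¹.2.1

/-- The character through which `L` acts on the centre of `Q` from the left. -/
noncomputable def cenChar (m : ℕ) (l : L k) : k := (l⁻¹.1 : k) ^ 2 * l⁻¹.2.1.det ^ m

theorem cenChar_mul (l l' : L k) : cenChar m (l * l') = cenChar m l * cenChar m l' := by
  simp only [cenChar, mul_inv_rev, Prod.fst_mul, Prod.snd_mul, Units.val_mul, Matrix.det_mul]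
  ring

theorem cenChar_one : cenChar m (1 : L k) = 1 := by simp [cenChar]

theorem cenChar_pow (l : L k) (n : ℕ) : cenChar m (l ^ n) = cenChar m l ^ n := by
  induction n with
  | zero => simp [cenChar_one]
  | succ n ih => rw [pow_succ, pow_succ, cenChar_mul, ih]

theorem actHom_apply (l : L k) (q : Q k m) :
    actHom p k m l q = ⟨linAct m l q.vec, cenChar m l * q.cen⟩ := rfl

/-- The central coordinate of a commutator in `Q` is a difference of two values of the form;
antisymmetry merges them into one value with factor 2. The formula also exhibits `Q` as normal in
`P`. -/
theorem conj_inl (hmodd : Odd m) (g : P p k m) (q : Q k m) :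
    g * inl q * g⁻¹ = inl ⟨linAct m g.right q.vec, cenChar m g.right * q.cen +
      2 * form k m g.left.vec (linAct m g.right q.vec)⟩ := by
  have h : g * inl q * g⁻¹ = inl (g.left * actHom p k m g.right q * g.left⁻¹) := by
    conv_lhs => rw [← inl_left_mul_inr_right g]
    rw [map_mul, map_mul, map_inv, inl_aut, map_inv]
    group
  rw [h, Q.conj_eq, actHom_apply]
  congr 2
  dsimp only
  rw [form_antisymm hmodd (linAct m g.right q.vec)]
  ring

theorem conj_inl_inl (hmodd : Odd m) (r q : Q k m) :
    (inl r * inl q * (inl r)⁻¹ : P p k m) =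
      inl ⟨q.vec, q.cen + 2 * form k m r.vec q.vec⟩ := by
  rw [← map_inv, ← map_mul, ← map_mul, Q.conj_eq]
  congr 2
  rw [form_antisymm hmodd q.vec]
  ring

theorem conj_inr_inl (l : L k) (q : Q k m) :
    (inr l * inl q * (inr l)⁻¹ : P p k m) =
      inl ⟨linAct m l q.vec, cenChar m l * q.cen⟩ := by
  rw [← map_inv, ← inl_aut]
  rfl

theorem mem_S {x : P p k m} : x ∈ S p k m ↔ x.right ∈ S₀ k := Iff.rfl

theorem inl_mem_S (q : Q k m) : (inl q : P p k m) ∈ S p k m := by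
  rw [mem_S, right_inl]; exact one_mem _

theorem S₀_eq_one {l : L k} (hl : l ∈ S₀ k) (h : l.2.1 1 0 = 0) : l = 1 := by
  obtain ⟨h1, h2, h3, h4⟩ := hl
  refine Prod.ext h1 (Units.ext ?_)
  ext i j
  fin_cases i <;> fin_cases j <;> simp [*]

theorem S₀_ext {l l' : L k} (hl : l ∈ S₀ k) (hl' : l' ∈ S₀ k) (h : l.2.1 1 0 = l'.2.1 1 0) :
    l = l' := by
  obtain ⟨h1, h2, h3, h4⟩ := hl
  obtain ⟨h1', h2', h3', h4'⟩ := hl'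
  refine Prod.ext (h1.trans h1'.symm) (Units.ext ?_)
  ext i j
  fin_cases i <;> fin_cases j <;> simp [*]

theorem linAct_S₀_linPow_ne (p : ℕ) [Fact p.Prime] [CharP k p] [hm : Fact (m < p)] (hm1 : 1 ≤ m)
    {l : L k} (hl : l ∈ S₀ k) (h : l ≠ 1) : linAct m l (linPow m 0 1) ≠ linPow m 0 1 := by
  have hl' := (S₀ k).inv_mem hl
  have h10 : l⁻¹.2.1 1 0 ≠ 0 := fun h0 => h (inv_eq_one.1 (S₀_eq_one hl' h0))
  have := substV_linPow_ne p hm.out hm1 h10 hl'.2.2.2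
  rw [linAct, hl'.1]
  simpa using this

/-- The element of `L` acting as the scalar `c` on `V_m`. -/
theorem exists_linAct_smul (m : ℕ) {c : k} (hc : c ≠ 0) :
    ∃ l : L k, ∀ v : V k m, linAct m l v = c • v := by
  refine ⟨((Units.mk0 c hc)⁻¹, 1), fun v => ?_⟩
  rw [linAct]
  simp [substV_one]

theorem exists_linAct_substV (m : ℕ) (A : GL (Fin 2) k) :
    ∃ l : L k, ∀ v : V k m, linAct m l v = substV m A.1 v := by
  refine ⟨(1, A⁻¹), fun v => ?_⟩
  rw [linAct]
  simp

theorem exists_cenChar_eq (hmodd : Odd m) {c : k} (hc : c ≠ 0) :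
    ∃ l : L k, cenChar m l = c := by
  obtain ⟨n, hn⟩ := hmodd
  have hdet : (!![c, 0; 0, 1] : Matrix (Fin 2) (Fin 2) k).det ≠ 0 := by
    simpa [Matrix.det_fin_two] using hc
  -- With m = 2n + 1, the choice t = c^(-n) and determinant c gives t² c^m = c; the outer inverse
  -- undoes the one in `cenChar`.
  refine ⟨((Units.mk0 (c ^ n) (pow_ne_zero n hc))⁻¹,
    Matrix.GeneralLinearGroup.mkOfDetNeZero _ hdet)⁻¹, ?_⟩
  rw [cenChar, inv_inv, hn]
  simp [Matrix.GeneralLinearGroup.mkOfDetNeZero, Matrix.det_fin_two]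
  field_simp
  ring

end Conjugation

/-! ### Subgroups of `S` closed under conjugation in `P` -/

section Closed

variable {p : ℕ} [Fact p.Prime] {k : Type u} [Field k] [CharP k p] {m : ℕ} [hm : Fact (m < p)]

/-- `M ≤ S` is closed under those conjugations by elements of `P` that stay in `S`. -/
structure ClosedInP (M : Subgroup (P p k m)) : Prop where
  le : M ≤ S p k m
  conj : ∀ g x : P p k m, x ∈ M → g * x * g⁻¹ ∈ S p k m → g * x * g⁻¹ ∈ M

namespace ClosedInP

variable {M : Subgroup (P p k m)}

theorem conj_mem_of_mem_S (hM : ClosedInP M) {s x : P p k m} (hs : s ∈ S p k m) (hx : x ∈ M) :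
    s * x * s⁻¹ ∈ M :=
  hM.conj s x hx ((S p k m).mul_mem ((S p k m).mul_mem hs (hM.le hx)) ((S p k m).inv_mem hs))

theorem conj_inl_mem (hM : ClosedInP M) (hmodd : Odd m) (g : P p k m) {q : Q k m}
    (hq : inl q ∈ M) : g * inl q * g⁻¹ ∈ M :=
  hM.conj g _ hq (by rw [conj_inl hmodd]; exact inl_mem_S _)

/-- The commutator of `x` with (y^m, 0) lies in `M ∩ Q`, and its vector is non-zero because a
non-trivial element of `S₀` moves y^m. -/
theorem exists_noncentral (hM : ClosedInP M) (hmodd : Odd m) (hm1 : 1 ≤ m) {x : P p k m}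
    (hx : x ∈ M) (hr : x.right ≠ 1) : ∃ q : Q k m, inl q ∈ M ∧ q.vec ≠ 0 := by
  let r : Q k m := ⟨linPow m 0 1, 0⟩
  have h1 := M.mul_mem hx
    (hM.conj_mem_of_mem_S (inl_mem_S r) (M.inv_mem hx))
  have h2 : x * (inl r * x⁻¹ * (inl r)⁻¹) = (x * inl r * x⁻¹) * inl r⁻¹ := by
    rw [map_inv]; group
  rw [h2, conj_inl hmodd, ← map_mul] at h1
  refine ⟨_, h1, ?_⟩
  rw [Q.mul_vec, Q.inv_vec, ← sub_eq_add_neg, sub_ne_zero]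
  exact linAct_S₀_linPow_ne p hm1 (hM.le hx) hr

/-- The commutator with (w, 0) is central with coordinate 2β(w, v), where v is the vector of `q`;
non-degeneracy provides a suitable w, and 2 is invertible. -/
theorem exists_central (hM : ClosedInP M) (hmodd : Odd m) (hp : 5 ≤ p) {q : Q k m}
    (hq : inl q ∈ M) (hv : q.vec ≠ 0) : ∃ c : k, c ≠ 0 ∧ (inl ⟨0, c⟩ : P p k m) ∈ M := by
  obtain ⟨w, hw⟩ := exists_form_ne_zero p hm.out hv
  have h1 := M.mul_mem (hM.conj_mem_of_mem_S (inl_mem_S ⟨w, 0⟩) hq) (M.inv_mem hq)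
  rw [conj_inl_inl hmodd, ← map_inv, ← map_mul] at h1
  have h2 : (⟨q.vec, q.cen + 2 * form k m w q.vec⟩ * q⁻¹ : Q k m) = ⟨0, 2 * form k m w q.vec⟩ := by
    apply Q.ext
    · simp [Q.mul_vec, Q.inv_vec]
    · simp only [Q.mul_cen, Q.inv_cen, Q.inv_vec, map_neg]; ring
  rw [h2] at h1
  refine ⟨_, mul_ne_zero ?_ ?_, h1⟩
  · intro h
    have : ((2 : ℕ) : k) = 0 := by exact_mod_cast h
    rw [CharP.cast_eq_zero_iff k p] at this
    exact absurd (Nat.le_of_dvd two_pos this) (by omega)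
  · rw [form_antisymm hmodd]; simpa using hw

theorem central_mem (hM : ClosedInP M) (hmodd : Odd m) {c : k} (hc : c ≠ 0)
    (h : (inl ⟨0, c⟩ : P p k m) ∈ M) (d : k) : (inl ⟨0, d⟩ : P p k m) ∈ M := by
  by_cases hd : d = 0
  · rw [hd]; exact (map_one (inl : Q k m →* P p k m)).symm ▸ M.one_mem
  · obtain ⟨l, hl⟩ := exists_cenChar_eq hmodd (div_ne_zero hd hc)
    have := hM.conj_inl_mem hmodd (inr l) h
    rw [conj_inr_inl, hl] at this
    simpa [hc] using this

theorem mem_of_vec_eq (hZ : ∀ d : k, (inl ⟨0, d⟩ : P p k m) ∈ M) {q r : Q k m}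
    (hq : inl q ∈ M) (h : r.vec = q.vec) : inl r ∈ M := by
  have h1 := M.mul_mem hq (hZ (r.cen - q.cen))
  rw [← map_mul] at h1
  have h2 : q * ⟨0, r.cen - q.cen⟩ = r := by
    apply Q.ext
    · simp [Q.mul_vec, h]
    · simp [Q.mul_cen]
  rwa [h2] at h1

/-- Once the centre lies in `M`, membership in `M` of an element of `Q` depends only on its vector.
The vectors that occur form a non-zero `L`-invariant subspace, so irreducibility applies. -/
theorem inl_mem (hM : ClosedInP M) (hmodd : Odd m) (hm1 : 1 ≤ m)
    (hZ : ∀ d : k, (inl ⟨0, d⟩ : P p k m) ∈ M) {q : Q k m} (hq : inl q ∈ M) (hv : q.vec ≠ 0)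
    (r : Q k m) : inl r ∈ M := by
  let X : Submodule k (V k m) :=
    { carrier := {v | (inl ⟨v, 0⟩ : P p k m) ∈ M}
      add_mem' := by
        intro v w hv hw
        have h := M.mul_mem (show (inl ⟨v, 0⟩ : P p k m) ∈ M from hv)
          (show (inl ⟨w, 0⟩ : P p k m) ∈ M from hw)
        rw [← map_mul] at h
        exact mem_of_vec_eq hZ h rfl
      zero_mem' := hZ 0
      smul_mem' := by
        intro c v hv
        by_cases hc : c = 0
        · rw [hc, zero_smul]; exact hZ 0
        · obtain ⟨l, hl⟩ := exists_linAct_smul m hc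
          have h := hM.conj_inl_mem hmodd (inr l) hv
          rw [conj_inr_inl] at h
          exact mem_of_vec_eq hZ h (hl v).symm }
  have hX : X = ⊤ := by
    refine submodule_eq_top p hm.out hm1 X ?_ ?_
    · intro A v hv
      obtain ⟨l, hl⟩ := exists_linAct_substV m A
      have h := hM.conj_inl_mem hmodd (inr l) hv
      rw [conj_inr_inl] at h
      exact mem_of_vec_eq hZ h (hl v).symm
    · exact (Submodule.ne_bot_iff X).2 ⟨q.vec, mem_of_vec_eq hZ hq rfl, hv⟩
  have h : r.vec ∈ X := hX ▸ Submodule.mem_top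
  exact mem_of_vec_eq hZ h rfl

theorem exists_central_of_ne_bot (hM : ClosedInP M) (hmodd : Odd m) (hp : 5 ≤ p) (hm1 : 1 ≤ m)
    {x : P p k m} (hx : x ∈ M) (h1 : x ≠ 1) : ∃ c : k, c ≠ 0 ∧ (inl ⟨0, c⟩ : P p k m) ∈ M := by
  by_cases hr : x.right = 1
  · have hx' : x = inl x.left := by ext1 <;> simp [hr]
    rw [hx'] at hx
    by_cases hv : x.left.vec = 0
    · refine ⟨x.left.cen, fun hc => h1 ?_, ?_⟩
      · rw [hx', show x.left = 1 from Q.ext hv hc, map_one]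
      · rwa [show (⟨0, x.left.cen⟩ : Q k m) = x.left from Q.ext hv.symm rfl]
    · exact hM.exists_central hmodd hp hx hv
  · obtain ⟨q, hq, hv⟩ := hM.exists_noncentral hmodd hm1 hx hr
    exact hM.exists_central hmodd hp hq hv

/-- A closed subgroup that is not contained in `Q` is all of `S`. -/
theorem eq_S (hM : ClosedInP M) (hmodd : Odd m) (hp : 5 ≤ p) (hm1 : 1 ≤ m)
    {x : P p k m} (hx : x ∈ M) (hr : x.right ≠ 1) : M = S p k m := by
  obtain ⟨q, hq, hv⟩ := hM.exists_noncentral hmodd hm1 hx hr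
  obtain ⟨c, hc, hcM⟩ := hM.exists_central hmodd hp hq hv
  have hQ := hM.inl_mem hmodd hm1 (hM.central_mem hmodd hc hcM) hq hv
  have hxr : inr x.right ∈ M := by
    have h : inr x.right = inl x.left⁻¹ * x := by
      rw [map_inv, eq_inv_mul_iff_mul_eq]
      exact inl_left_mul_inr_right x
    rw [h]
    exact M.mul_mem (hQ _) hx
  refine le_antisymm hM.le fun s hs => ?_
  rw [← inl_left_mul_inr_right s]
  refine M.mul_mem (hQ _) ?_
  have hs0 : s.right ∈ S₀ k := hs
  have hx0 : x.right ∈ S₀ k := hM.le hx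
  by_cases h : s.right.2.1 1 0 = 0
  · rw [S₀_eq_one hs0 h, map_one]; exact M.one_mem
  have hx10 : x.right.2.1 1 0 ≠ 0 := fun h0 => hr (S₀_eq_one hx0 h0)
  -- Conjugation by diag(a, 1) divides the lower left entry by a.
  set a := x.right.2.1 1 0 / s.right.2.1 1 0 with ha
  have ha0 : a ≠ 0 := div_ne_zero hx10 h
  let A : GL (Fin 2) k := ⟨!![a, 0; 0, 1], !![a⁻¹, 0; 0, 1],
    by ext i j; fin_cases i <;> fin_cases j <;> simp [ha0],
    by ext i j; fin_cases i <;> fin_cases j <;> simp [ha0]⟩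
  have hconj : (A * x.right.2 * A⁻¹).1 = !![1, 0; s.right.2.1 1 0, 1] := by
    obtain ⟨h1, h2, h3, h4⟩ := hx0
    rw [Units.val_mul, Units.val_mul]
    have e : x.right.2.1 1 0 * a⁻¹ = s.right.2.1 1 0 := by rw [ha]; field_simp
    ext i j
    change (!![a, 0; 0, 1] * x.right.2.1 * !![a⁻¹, 0; 0, 1]) i j = _
    fin_cases i <;> fin_cases j <;>
      simp only [Matrix.mul_apply, Fin.sum_univ_two] <;> simp [h2, h3, h4, ha0, e]
  have hmem : ((1, A) : L k) * x.right * (1, A)⁻¹ ∈ S₀ k := by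
    refine ⟨?_, ?_⟩
    · change 1 * x.right.1 * 1⁻¹ = 1
      rw [hx0.1]; simp
    · change (A * x.right.2 * A⁻¹).1 0 0 = 1 ∧ (A * x.right.2 * A⁻¹).1 0 1 = 0 ∧
        (A * x.right.2 * A⁻¹).1 1 1 = 1
      rw [hconj]; simp
  have hEq : s.right = ((1, A) : L k) * x.right * (1, A)⁻¹ := by
    refine S₀_ext hs0 hmem ?_
    change _ = (A * x.right.2 * A⁻¹).1 1 0
    rw [hconj]; simp
  rw [hEq, map_mul, map_mul, map_inv]
  refine hM.conj _ _ hxr ?_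
  rw [← map_inv, ← map_mul, ← map_mul, mem_S, right_inr]
  exact hmem

end ClosedInP

end Closed

end ParkerStroth
namespace ParkerStroth

open MvPolynomial SemidirectProduct

/-! ### The kernel of the action and the p-elements of `P₁` -/

section PElements

variable {p : ℕ} [Fact p.Prime] {k : Type u} [Field k] [CharP k p] {m : ℕ} [hm : Fact (m < p)]

theorem mem_ker_actHom {l : L k} :
    l ∈ (actHom p k m).ker ↔ (∀ v : V k m, linAct m l v = v) ∧ cenChar m l = 1 := by
  constructor
  · intro h
    have h' : ∀ q : Q k m, actHom p k m l q = q := fun q => by rw [MonoidHom.mem_ker.1 h]; rfl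
    refine ⟨fun v => congrArg Q.vec (h' ⟨v, 0⟩), ?_⟩
    simpa [actHom_apply] using congrArg Q.cen (h' ⟨0, 1⟩)
  · rintro ⟨h1, h2⟩
    rw [MonoidHom.mem_ker]
    ext1 q
    rw [actHom_apply, h1, h2, one_mul]
    rfl

theorem mem_centL {x : P p k m} :
    x ∈ centL p k m ↔ x.left = 1 ∧ x.right ∈ (actHom p k m).ker := by
  constructor
  · rintro ⟨l, hl, rfl⟩
    exact ⟨rfl, hl⟩
  · rintro ⟨h1, h2⟩
    exact ⟨x.right, h2, by ext1 <;> simp [h1]⟩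

theorem mk_inl_injective {q r : Q k m}
    (h : (QuotientGroup.mk' (centL p k m)) (inl q) = QuotientGroup.mk' (centL p k m) (inl r)) :
    q = r := by
  have h1 := (mem_centL.1 (QuotientGroup.eq.1 h)).1
  rw [← map_inv, ← map_mul, left_inl] at h1
  exact inv_mul_eq_one.1 h1

theorem substV_scalar (p : ℕ) [Fact p.Prime] [CharP k p] (hm : m < p) (b : k) (v : V k m) :
    substV m (Matrix.scalar (Fin 2) b) v = b ^ m • v := by
  -- The claim is clear on powers of linear forms. Pairing the difference with a fixed `w` gives a
  -- functional that vanishes on them, so the difference is in the radical of the form.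
  rw [← sub_eq_zero]
  by_contra h
  obtain ⟨w, hw⟩ := exists_form_ne_zero p hm h
  have h2 := functional_eq_zero p hm (((form k m).flip w).comp
    (substV m (Matrix.scalar (Fin 2) b) - b ^ m • LinearMap.id)) (by
      intro c d
      have h3 : substV m (Matrix.scalar (Fin 2) b) (linPow m c d) = b ^ m • linPow m c d := by
        rw [substV_linPow]
        refine V_ext fun a ha => ?_
        rw [Submodule.coe_smul, coeff_smul, coeff_linPow m _ _ a ha, coeff_linPow m _ _ a ha]
        have e : b ^ m = b ^ a * b ^ (m - a) := by rw [← pow_add, Nat.add_sub_cancel' ha]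
        simp [e]
        ring
      rw [LinearMap.comp_apply, LinearMap.sub_apply, h3]
      simp)
  exact hw (by simpa using LinearMap.congr_fun h2 v)

/-- The scalar elements of `L` that act trivially on `Q`. -/
theorem scalar_mem_ker (b : kˣ) :
    ((b ^ m, (Matrix.GeneralLinearGroup.scalar (Fin 2) b)⁻¹) : L k) ∈ (actHom p k m).ker := by
  have hb : b⁻¹.1 ^ m * b.1 ^ m = 1 := by rw [← mul_pow]; simp
  rw [mem_ker_actHom]
  constructor
  · intro v
    rw [linAct]
    simp only [Prod.fst_inv, Prod.snd_inv, inv_inv, LinearMap.smul_apply]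
    have : (Matrix.GeneralLinearGroup.scalar (Fin 2) b).1 = Matrix.scalar (Fin 2) b.1 := rfl
    rw [this, substV_scalar p hm.out, smul_smul, ← inv_pow, Units.val_pow_eq_pow_val, hb, one_smul]
  · rw [cenChar]
    simp only [Prod.fst_inv, Prod.snd_inv, inv_inv]
    have : (Matrix.GeneralLinearGroup.scalar (Fin 2) b).1 = Matrix.scalar (Fin 2) b.1 := rfl
    rw [this, ← inv_pow, Units.val_pow_eq_pow_val]
    simp only [Matrix.scalar_apply, Matrix.det_diagonal, Fin.prod_univ_two]
    linear_combination (b⁻¹.1 ^ m * b.1 ^ m + 1) * hb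

theorem exists_eq_scalar_of_mem_ker (hm1 : 1 ≤ m) {l : L k} (hl : l ∈ (actHom p k m).ker) :
    ∃ a : k, l.2.1 = Matrix.scalar (Fin 2) a ∧ (l.1 : k) * a ^ m = 1 := by
  have h := (mem_ker_actHom.1 ((actHom p k m).ker.inv_mem hl)).1
  simp only [linAct, inv_inv, LinearMap.smul_apply] at h
  obtain ⟨h1, h2, h3, h4⟩ := scalar_of_smul_substV_eq p hm.out hm1 h
  refine ⟨_, ?_, h4⟩
  ext i j
  fin_cases i <;> fin_cases j <;> simp [*]

theorem cenChar_eq_one_of_pow_mem {y : P p k m} {j : ℕ} (hy : y ^ p ^ j ∈ centL p k m) :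
    cenChar m y.right = 1 := by
  have h := (mem_ker_actHom.1 (mem_centL.1 hy).2).2
  have h2 : (y ^ p ^ j).right = y.right ^ p ^ j := map_pow rightHom y _
  rw [h2, cenChar_pow] at h
  exact eq_one_of_pow_char_pow p h

/-- An element of `P` whose image in `P₁` has `p`-power order is conjugate into `S` modulo
`C_L(Q)`. -/
theorem exists_conj_mem_S [Finite k] (hm1 : 1 ≤ m) {y : P p k m} {j : ℕ}
    (hy : y ^ p ^ j ∈ centL p k m) :
    ∃ g s : P p k m, s ∈ S p k m ∧ (QuotientGroup.mk' (centL p k m)) s =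
      QuotientGroup.mk' (centL p k m) (g * y * g⁻¹) := by
  have h := (mem_centL.1 hy).2
  have h2 : (y ^ p ^ j).right = y.right ^ p ^ j := map_pow rightHom y _
  rw [h2] at h
  obtain ⟨a, ha, hta⟩ := exists_eq_scalar_of_mem_ker hm1 h
  -- A finite field is perfect, so the scalar has a p^j-th root b. The matrix part is then b times a
  -- unipotent matrix, and the factor b can be removed by a scalar element of `C_L(Q)`.
  obtain ⟨b, rfl⟩ := (bijective_iterateFrobenius k p j).2 a
  rw [iterateFrobenius_def] at ha hta
  have hb0 : b ≠ 0 := by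
    rintro rfl
    rw [zero_pow (pow_ne_zero _ (Fact.out : p.Prime).ne_zero), zero_pow (by omega)] at hta
    simp at hta
  have ha' : y.right.2.1 ^ p ^ j = Matrix.scalar (Fin 2) (b ^ p ^ j) := by
    rw [← ha]; simp
  obtain ⟨g, hg01, hg00, hg11⟩ := exists_conj_lower p ha'
  have ht : (y.right.1 : k) * b ^ m = 1 := by
    apply eq_one_of_pow_char_pow p (j := j)
    rw [mul_pow, ← pow_mul, mul_comm m, pow_mul, ← hta]
    simp
  let B : kˣ := Units.mk0 b hb0
  have hker := scalar_mem_ker (p := p) (m := m) B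
  refine ⟨inr (1, g), inr (1, g) * y * (inr (1, g))⁻¹ *
    inr (B ^ m, (Matrix.GeneralLinearGroup.scalar (Fin 2) B)⁻¹), ?_, ?_⟩
  · rw [mem_S]
    have e : (inr (1, g) * y * (inr (1, g))⁻¹ *
        inr (B ^ m, (Matrix.GeneralLinearGroup.scalar (Fin 2) B)⁻¹) : P p k m).right =
        (1 * y.right.1 * 1⁻¹ * B ^ m,
          g * y.right.2 * g⁻¹ * (Matrix.GeneralLinearGroup.scalar (Fin 2) B)⁻¹) := rfl
    rw [e]
    have e2 : ((Matrix.GeneralLinearGroup.scalar (Fin 2) B)⁻¹).1 = Matrix.scalar (Fin 2) b⁻¹ := rfl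
    refine ⟨?_, ?_⟩
    · apply Units.ext
      simpa [B] using ht
    · dsimp only
      rw [Units.val_mul, e2, Matrix.scalar_apply]
      simp only [Matrix.mul_diagonal, hg01, hg00, hg11]
      simp [hb0]
  · rw [map_mul]
    have : (QuotientGroup.mk' (centL p k m)) (inr (B ^ m,
        (Matrix.GeneralLinearGroup.scalar (Fin 2) B)⁻¹)) = 1 :=
      (QuotientGroup.eq_one_iff _).2 (mem_centL.2 ⟨rfl, hker⟩)
    rw [this, mul_one]

/-- `P` acts on the centre of `Q` through a character with values in k, and such a character is
trivial on p-elements. -/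
theorem commute_central (hmodd : Odd m) {y : P₁ p k m} {j : ℕ} (hy : y ^ p ^ j = 1) (c : k) :
    Commute y (QuotientGroup.mk' (centL p k m) (inl ⟨0, c⟩)) := by
  obtain ⟨y, rfl⟩ := QuotientGroup.mk'_surjective _ y
  rw [← map_pow] at hy
  have h := cenChar_eq_one_of_pow_mem ((QuotientGroup.eq_one_iff _).1 hy)
  have h2 : y * inl ⟨0, c⟩ * y⁻¹ = inl ⟨0, c⟩ := by
    rw [conj_inl hmodd, h]
    simp
  have h3 := congrArg (QuotientGroup.mk' (centL p k m)) (mul_inv_eq_iff_eq_mul.1 h2)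
  rw [map_mul, map_mul] at h3
  exact h3

end PElements

end ParkerStroth

/-! ### Strong closure in terms of conjugation of elements -/

theorem FusionSystem.StronglyClosed.conj_mem {G : Type u} [Group G] {S : Subgroup G}
    {N : Subgroup S} (hN : (FusionSystem.ofGroup S).StronglyClosed N) {x : G}
    (hx : x ∈ N.map S.subtype) (g : G) (hg : g * x * g⁻¹ ∈ S) :
    g * x * g⁻¹ ∈ N.map S.subtype := by
  obtain ⟨x, hxN, rfl⟩ := hx
  -- The morphism to use is conjugation by `g` on the cyclic group generated by `x`, whose image
  -- stays in `S`.
  let c : Subgroup.zpowers x →* G :=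
    (MulAut.conj g).toMonoidHom.comp (S.subtype.comp (Subgroup.zpowers x).subtype)
  have hc : ∀ y, c y ∈ S := by
    rintro ⟨_, n, rfl⟩
    have h := S.zpow_mem hg n
    rw [conj_zpow] at h
    simpa [c] using h
  let f : Subgroup.zpowers x →* (⊤ : Subgroup S) :=
    Subgroup.topEquiv.symm.toMonoidHom.comp (c.codRestrict S hc)
  have h := hN _ _ f ⟨g, fun _ => rfl⟩ ⟨x, Subgroup.mem_zpowers x⟩ hxN
  exact ⟨_, h, rfl⟩

namespace ParkerStroth

open SemidirectProduct

/-! ### The position of `W₀` relative to `Q` -/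

namespace AmalgamData

variable {p : ℕ} [Fact p.Prime] {k : Type u} [Field k] [CharP k p] {m : ℕ} [hm : Fact (m < p)]
variable (D : AmalgamData p k m)

/-- The embedding of `C` into `P₁`. -/
noncomputable def embP : Cgp k →* P₁ p k m :=
  (Subgroup.normalizer (D.W₀ : Set (P₁ p k m))).subtype.comp D.iso.toMonoidHom

theorem embP_injective : Function.Injective D.embP :=
  Subtype.val_injective.comp D.iso.injective

theorem exists_embP_eq {x : P₁ p k m} (hx : x ∈ Subgroup.normalizer (D.W₀ : Set (P₁ p k m))) :
    ∃ c, D.embP c = x :=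
  ⟨D.iso.symm ⟨x, hx⟩, congrArg Subtype.val (D.iso.apply_symm_apply ⟨x, hx⟩)⟩

theorem embP_mem_W₀ {c : Cgp k} :
    D.embP c ∈ D.W₀ ↔ Subgroup.inclusion (Cgp_le_K k) c ∈ wGroup k := by
  have h := SetLike.ext_iff.1 D.map_W (D.embP c)
  rw [h]
  constructor
  · rintro ⟨_, ⟨c', hc', rfl⟩, h'⟩
    rw [D.embP_injective (show D.embP c' = D.embP c from h')] at hc'
    rwa [normalPCore_K p] at hc'
  · intro h'
    refine ⟨_, ⟨c, ?_, rfl⟩, rfl⟩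
    change _ ∈ normalPCore p (K k)
    rwa [normalPCore_K p]

theorem exists_of_mem_W₀ {w : P₁ p k m} (hw : w ∈ D.W₀) :
    ∃ c, D.embP c = w ∧ Subgroup.inclusion (Cgp_le_K k) c ∈ wGroup k := by
  obtain ⟨c, rfl⟩ := D.exists_embP_eq (Subgroup.le_normalizer hw)
  exact ⟨c, rfl, D.embP_mem_W₀.1 hw⟩

theorem pow_char_of_mem_W₀ {w : P₁ p k m} (hw : w ∈ D.W₀) : w ^ p ^ 1 = 1 := by
  obtain ⟨c, rfl, hc⟩ := D.exists_of_mem_W₀ hw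
  have h := wGroup_pow_char p hc
  rw [← map_pow] at h
  rw [pow_one, ← map_pow, Subgroup.inclusion_injective _ (h.trans (map_one _).symm), map_one]

instance [Finite k] : Finite D.W₀ := by
  refine Finite.of_surjective
    (fun c : {c : Cgp k // Subgroup.inclusion (Cgp_le_K k) c ∈ wGroup k} =>
      (⟨D.embP c.1, D.embP_mem_W₀.2 c.2⟩ : D.W₀)) ?_
  rintro ⟨w, hw⟩
  obtain ⟨c, rfl, hc⟩ := D.exists_of_mem_W₀ hw
  exact ⟨⟨c, hc⟩, rfl⟩

theorem mem_normalizer_W₀ [Finite k] {g : P₁ p k m} (h : ∀ w ∈ D.W₀, g * w * g⁻¹ ∈ D.W₀) :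
    ∃ c, D.embP c = g := by
  have : Finite (D.W₀ : Set (P₁ p k m)) := inferInstanceAs (Finite D.W₀)
  exact D.exists_embP_eq (Subgroup.mem_normalizer_fintype h)

/-- The embedding of `Q` into `P₁`. -/
noncomputable def embQ (p : ℕ) [Fact p.Prime] (k : Type u) [Field k] [CharP k p] (m : ℕ)
    [Fact (m < p)] : Q k m →* P₁ p k m :=
  (QuotientGroup.mk' (centL p k m)).comp inl

theorem embQ_injective : Function.Injective (embQ p k m) := fun _ _ h => mk_inl_injective h

theorem cMat_mem_W₀ : D.embP (cMat 1 0 1 0 1 (by ring)) ∈ D.W₀ :=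
  D.embP_mem_W₀.2 ⟨rfl, rfl, rfl, rfl⟩

/-- The centre of `Q` is contained in `W₀`. -/
theorem central_mem_W₀ [Finite k] (hmodd : Odd m) (c : k) : embQ p k m ⟨0, c⟩ ∈ D.W₀ := by
  -- Centralising `W₀` puts the element into the normaliser, hence into the image of C, where W
  -- contains its own centraliser.
  have hcomm : ∀ w ∈ D.W₀, Commute w (embQ p k m ⟨0, c⟩) := fun w hw =>
    commute_central hmodd (D.pow_char_of_mem_W₀ hw) c
  obtain ⟨e, he⟩ := D.mem_normalizer_W₀ (g := embQ p k m ⟨0, c⟩) (fun w hw => by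
    rw [← (hcomm w hw).eq, mul_inv_cancel_right]; exact hw)
  rw [← he, D.embP_mem_W₀]
  apply mem_wGroup_of_commute
  have h := hcomm _ D.cMat_mem_W₀
  rw [← he] at h
  apply D.embP_injective
  rw [map_mul, map_mul]
  exact h.symm

theorem embQ_mem_W₀_of_vec_eq [Finite k] (hmodd : Odd m) {q r : Q k m}
    (hq : embQ p k m q ∈ D.W₀) (h : r.vec = q.vec) : embQ p k m r ∈ D.W₀ := by
  have h1 := D.W₀.mul_mem hq (D.central_mem_W₀ hmodd (r.cen - q.cen))
  rw [← map_mul] at h1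
  have h2 : q * ⟨0, r.cen - q.cen⟩ = r := by
    apply Q.ext
    · simp [Q.mul_vec, h]
    · simp [Q.mul_cen]
  rwa [h2] at h1

/-- Central elements of `Q` commute with all p-elements of `P₁`, whereas W contains an element that
fails to commute with a p-element of C. -/
theorem exists_noncentral_mem_W₀ (hmodd : Odd m)
    (hQ : ∀ w ∈ D.W₀, ∃ q, embQ p k m q = w) : ∃ q, embQ p k m q ∈ D.W₀ ∧ q.vec ≠ 0 := by
  obtain ⟨q, hq⟩ := hQ _ D.cMat_mem_W₀
  refine ⟨q, hq ▸ D.cMat_mem_W₀, fun h0 => not_commute_cMat (k := k) ?_⟩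
  have hT : D.embP (cMat 0 0 1 1 1 (by ring)) ^ p ^ 1 = 1 := by
    rw [pow_one, ← map_pow, cMat_pow_char p, map_one]
  have h := commute_central hmodd hT q.cen
  have hq' : q = ⟨0, q.cen⟩ := Q.ext h0 rfl
  change Commute _ (embQ p k m _) at h
  rw [← hq', hq] at h
  apply D.embP_injective
  rw [map_mul, map_mul]
  exact h

/-- Conjugation by `Q` changes elements of `Q` only by central ones, and these lie in `W₀`; so `Q`
normalises `W₀`. As a p-group, it lands in the unipotent part of C. -/
theorem exists_embP_eq_embQ [Finite k] (hmodd : Odd m)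
    (hQ : ∀ w ∈ D.W₀, ∃ q, embQ p k m q = w) (q : Q k m) :
    ∃ c : Cgp k, D.embP c = embQ p k m q ∧ c.1.1 1 1 = 1 := by
  obtain ⟨c, hc⟩ := D.mem_normalizer_W₀ (g := embQ p k m q) (fun w hw => by
    obtain ⟨r, rfl⟩ := hQ w hw
    rw [← map_inv, ← map_mul, ← map_mul, Q.conj_eq]
    exact D.embQ_mem_W₀_of_vec_eq hmodd hw rfl)
  refine ⟨c, hc, Cgp_diag_eq_one p (j := 2) (D.embP_injective ?_)⟩
  rw [map_pow, hc, ← map_pow, Q.pow_char_sq, map_one, map_one]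

/-- If `W₀ ≤ Q` then `m = 1` and `Q` is the full unipotent subgroup of `C`. -/
theorem eq_one_and_surjective [Finite k] (hmodd : Odd m) (hm1 : 1 ≤ m)
    (hQ : ∀ w ∈ D.W₀, ∃ q, embQ p k m q = w) :
    m = 1 ∧ ∀ c : Cgp k, c.1.1 1 1 = 1 → ∃ q, embQ p k m q = D.embP c := by
  choose ψ hψ hψ1 using D.exists_embP_eq_embQ hmodd hQ
  let Ψ : Q k m → {M : Cgp k // M.1.1 1 1 = 1} := fun q => ⟨ψ q, hψ1 q⟩
  have hinj : Function.Injective Ψ := fun q r h => by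
    apply embQ_injective (p := p)
    rw [← hψ, ← hψ]
    exact congrArg (fun x => D.embP x.1) h
  -- The order |k|^(m+2) of `Q` is at most |k|^3, so m ≤ 1; equality of the orders then makes the
  -- injection bijective.
  have h1 := (Nat.card_le_card_of_injective Ψ hinj).trans card_Cgp_unipotent_le
  have hk : 1 < Nat.card k := Finite.one_lt_card
  rw [Q.card, Nat.pow_le_pow_iff_right hk] at h1
  obtain rfl : m = 1 := by omega
  refine ⟨rfl, fun c hc => ?_⟩
  have hbij : Function.Bijective Ψ := hinj.bijective_of_nat_card_le (by
    rw [Q.card]; exact card_Cgp_unipotent_le)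
  obtain ⟨q, hq⟩ := hbij.2 ⟨c, hc⟩
  exact ⟨q, (hψ q).symm.trans (congrArg (fun x => D.embP x.1) hq)⟩

/-- If `W₀ ≤ Q` then the image of `W₀` in `V_m` is a `k`-subspace. -/
theorem smul_mem_W₀ [Finite k] (hmodd : Odd m) (hp : 5 ≤ p)
    (hQ : ∀ w ∈ D.W₀, ∃ q, embQ p k m q = w) {v : V k m}
    (hv : embQ p k m ⟨v, 0⟩ ∈ D.W₀) (c : k) : embQ p k m ⟨c • v, 0⟩ ∈ D.W₀ := by
  -- The involution acts k-linearly on `V k m`. It is trivial modulo the image of `W₀` and inverts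
  -- that image.
  obtain ⟨g, hg⟩ := QuotientGroup.mk'_surjective _ (D.embP (hMat k))
  have hconj : ∀ q : Q k m, ∃ d, D.embP (hMat k) * embQ p k m q * (D.embP (hMat k))⁻¹ =
      embQ p k m ⟨linAct m g.right q.vec, d⟩ := by
    intro q
    rw [← hg]
    refine ⟨_, (congrArg (QuotientGroup.mk' (centL p k m)) (conj_inl hmodd g q))⟩
  have hsub : ∀ v : V k m, embQ p k m ⟨linAct m g.right v - v, 0⟩ ∈ D.W₀ := by
    intro v
    obtain ⟨e, he, he1⟩ := D.exists_embP_eq_embQ hmodd hQ ⟨v, 0⟩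
    have h := D.embP_mem_W₀.2 (hMat_comm_mem he1)
    obtain ⟨d, hd⟩ := hconj ⟨v, 0⟩
    rw [map_mul, map_mul, map_mul, map_inv, map_inv, he, hd, ← map_inv, ← map_mul] at h
    refine D.embQ_mem_W₀_of_vec_eq hmodd h ?_
    rw [Q.mul_vec, Q.inv_vec, sub_eq_add_neg]
  have hneg : linAct m g.right v = -v := by
    obtain ⟨e, he, he1⟩ := D.exists_of_mem_W₀ hv
    have h := congrArg D.embP (hMat_conj_eq_inv he1)
    obtain ⟨d, hd⟩ := hconj ⟨v, 0⟩
    rw [map_mul, map_mul, map_mul, map_inv, he, hd, ← map_mul, map_one,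
      ← map_one (embQ p k m)] at h
    exact eq_neg_of_add_eq_zero_left (congrArg Q.vec (embQ_injective h))
  have h2 : (2 : k) ≠ 0 := by
    intro h
    have : ((2 : ℕ) : k) = 0 := by exact_mod_cast h
    rw [CharP.cast_eq_zero_iff k p] at this
    exact absurd (Nat.le_of_dvd two_pos this) (by omega)
  -- By linearity the involution also negates multiples of v, so its commutator with -(c/2)v is
  -- exactly c v.
  have h := hsub ((-(c / 2)) • v)
  rw [map_smul, hneg] at h
  rwa [smul_neg, neg_smul, neg_neg, sub_neg_eq_add, ← add_smul, ← mul_two,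
    div_mul_cancel₀ c h2] at h

/-- `W₀` is not contained in `Q`. -/
theorem not_W₀_le_Q [Finite k] (hmodd : Odd m) (hp : 5 ≤ p) (hm1 : 1 ≤ m) :
    ¬ ∀ w ∈ D.W₀, ∃ q, embQ p k m q = w := by
  intro hQ
  obtain ⟨rfl, hsurj⟩ := D.eq_one_and_surjective hmodd hm1 hQ
  obtain ⟨u, hu, hu0⟩ := D.exists_noncentral_mem_W₀ hmodd hQ
  obtain ⟨A, hAp, hA⟩ := exists_transvection p u.vec
  let l : L k := (1, A⁻¹)
  have hl : ∀ v, linAct 1 l v = v + form k 1 v u.vec • u.vec := by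
    intro v
    rw [← hA, linAct]
    simp [l]
  have hlp : l ^ p = 1 := by
    refine Prod.ext (one_pow _) ?_
    change A⁻¹ ^ p = 1
    rw [inv_pow, hAp, inv_one]
  -- The transvection adds a multiple of `u.vec` to each vector. All such multiples come from `W₀`,
  -- so the transvection normalises `W₀`.
  obtain ⟨c, hc⟩ := D.mem_normalizer_W₀ (g := QuotientGroup.mk' (centL p k 1) (inr l)) (by
    intro w hw
    obtain ⟨q, rfl⟩ := hQ w hw
    have h1 : QuotientGroup.mk' (centL p k 1) (inr l) * embQ p k 1 q *
        (QuotientGroup.mk' (centL p k 1) (inr l))⁻¹ =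
        embQ p k 1 ⟨linAct 1 l q.vec, cenChar 1 l * q.cen⟩ :=
      congrArg (QuotientGroup.mk' (centL p k 1)) (conj_inr_inl l q)
    rw [h1]
    have h2 := D.smul_mem_W₀ hmodd hp hQ (D.embQ_mem_W₀_of_vec_eq hmodd (r := ⟨u.vec, 0⟩) hu rfl)
      (form k 1 q.vec u.vec)
    have h3 := D.W₀.mul_mem hw h2
    rw [← map_mul] at h3
    exact D.embQ_mem_W₀_of_vec_eq hmodd h3 (hl q.vec))
  have hc1 : c.1.1 1 1 = 1 := by
    refine Cgp_diag_eq_one p (j := 1) (D.embP_injective ?_)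
    rw [map_pow, hc, pow_one, ← map_pow, ← map_pow, hlp, map_one, map_one, map_one]
  obtain ⟨q, hq⟩ := hsurj c hc1
  rw [hc] at hq
  have h := (mem_centL.1 (QuotientGroup.eq.1 hq)).2
  -- An element of `L` that agrees with an element of `Q` modulo `C_L(Q)` acts trivially on `Q`, but
  -- the transvection moves any v with β(u, v) ≠ 0.
  have h1 : ((inl q : P p k 1)⁻¹ * inr l).right = l := by simp
  rw [h1, mem_ker_actHom] at h
  obtain ⟨v, hv⟩ := exists_form_ne_zero p hm.out hu0
  have h2 := h.1 v
  rw [hl, add_eq_left, smul_eq_zero] at h2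
  rcases h2 with h2 | h2
  · rw [form_antisymm hmodd, h2, neg_zero] at hv
    exact hv rfl
  · exact hu0 h2

/-- The map from `P` to the amalgam. -/
noncomputable def ofP : P p k m →* D.G :=
  MonoidHom.comp (N := P₁ p k m) (Monoid.PushoutI.of (φ := D.emb) true)
    (QuotientGroup.mk' (centL p k m))

theorem mem_SG {x : D.G} : x ∈ D.SG ↔ ∃ s ∈ S p k m, D.ofP s = x := by
  constructor
  · rintro ⟨_, ⟨s, hs, rfl⟩, rfl⟩
    exact ⟨s, hs, rfl⟩
  · rintro ⟨s, hs, rfl⟩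
    exact ⟨_, ⟨s, hs, rfl⟩, rfl⟩

/-- The elements of `C` that are conjugate in `K` become conjugate in the amalgam. -/
theorem isConj_of {c c' : Cgp k}
    (h : IsConj (Subgroup.inclusion (Cgp_le_K k) c) (Subgroup.inclusion (Cgp_le_K k) c')) :
    IsConj (Monoid.PushoutI.of (φ := D.emb) true (D.embP c))
      (Monoid.PushoutI.of (φ := D.emb) true (D.embP c')) := by
  have key : ∀ c, Monoid.PushoutI.of (φ := D.emb) true (D.embP c) =
      Monoid.PushoutI.of (φ := D.emb) false (Subgroup.inclusion (Cgp_le_K k) c) := fun c =>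
    (Monoid.PushoutI.of_apply_eq_base D.emb true c).trans
      (Monoid.PushoutI.of_apply_eq_base D.emb false c).symm
  rw [key, key]
  exact (Monoid.PushoutI.of (φ := D.emb) false).map_isConj h

end AmalgamData

end ParkerStroth

/-! ### Reduction simplicity -/

open ParkerStroth SemidirectProduct in
theorem lemma3p1 (p : ℕ) [Fact p.Prime] (hp : 5 ≤ p)
    (k : Type u) [Field k] [Finite k] [CharP k p]
    (m : ℕ) (hm1 : 1 ≤ m) [Fact (m < p)] (hmodd : Odd m)
    (D : ParkerStroth.AmalgamData p k m) :
    D.fusionSystem.ReductionSimple := by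
  intro N hN
  rw [or_iff_not_imp_left]
  intro hbot
  let M : Subgroup (P p k m) := S p k m ⊓ (N.map D.SG.subtype).comap D.ofP
  have hM : ClosedInP M := by
    refine ⟨inf_le_left, fun g x hx hg => ⟨hg, ?_⟩⟩
    change D.ofP _ ∈ N.map D.SG.subtype
    have h := FusionSystem.StronglyClosed.conj_mem hN hx.2 (D.ofP g)
    rw [← map_inv, ← map_mul, ← map_mul] at h
    exact h (D.mem_SG.2 ⟨_, hg, rfl⟩)
  obtain ⟨n, hn1⟩ := N.ne_bot_iff_exists_ne_one.1 hbot
  obtain ⟨s, hs, hsn⟩ := D.mem_SG.1 n.1.2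
  have hsM : s ∈ M := ⟨hs, ⟨n.1, n.2, hsn.symm⟩⟩
  have hs1 : s ≠ 1 := by
    rintro rfl
    rw [map_one] at hsn
    exact hn1 (Subtype.ext (Subtype.ext hsn.symm))
  obtain ⟨c, hc, hcM⟩ := hM.exists_central_of_ne_bot hmodd hp hm1 hsM hs1
  suffices hMS : M = S p k m by
    rw [eq_top_iff]
    rintro ⟨x, hx⟩ -
    obtain ⟨s, hs, rfl⟩ := D.mem_SG.1 hx
    obtain ⟨y, hy, hyx⟩ := (hMS ▸ hs : s ∈ M).2
    rwa [show y = ⟨D.ofP s, hx⟩ from Subtype.ext hyx] at hy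
  by_contra hMS
  -- If `M ≠ S` then `M ≤ Q`; fusing `w` with the central element found above will place `w` in `Q`.
  refine D.not_W₀_le_Q hmodd hp hm1 fun w hw => ?_
  by_cases hw1 : w = 1
  · exact ⟨1, by rw [hw1, map_one]⟩
  obtain ⟨y, rfl⟩ := QuotientGroup.mk'_surjective _ w
  have hpow := D.pow_char_of_mem_W₀ hw
  rw [← map_pow] at hpow
  obtain ⟨g, t, ht, hgt⟩ := exists_conj_mem_S hm1 ((QuotientGroup.eq_one_iff _).1 hpow)
  obtain ⟨e, he, heW⟩ := D.exists_of_mem_W₀ hw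
  obtain ⟨e₀, he₀, he₀W⟩ := D.exists_of_mem_W₀ (D.central_mem_W₀ hmodd c)
  have hconj := D.isConj_of (isConj_of_mem_wGroup he₀W (by
    intro h
    rw [Subgroup.inclusion_injective _ (h.trans (map_one _).symm), map_one,
      ← map_one (AmalgamData.embQ p k m)] at he₀
    exact hc (congrArg Q.cen (AmalgamData.embQ_injective he₀)).symm) heW (by
    intro h
    rw [Subgroup.inclusion_injective _ (h.trans (map_one _).symm), map_one] at he
    exact hw1 he.symm))
  rw [he, he₀] at hconj
  obtain ⟨κ, hκ⟩ := isConj_iff.1 hconj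
  -- Here κ comes from `K` and `g` from `P`: their product carries the central element of `M` to
  -- `t`, which lies in `S`, so strong closure gives `t ∈ M`.
  have hjt : D.ofP t = (D.ofP g * κ) * D.ofP (inl ⟨0, c⟩) * (D.ofP g * κ)⁻¹ := by
    have h1 : D.ofP t = D.ofP g * D.ofP y * (D.ofP g)⁻¹ := by
      rw [← map_inv, ← map_mul, ← map_mul]
      exact congrArg (Monoid.PushoutI.of (φ := D.emb) true) hgt
    have h2 : D.ofP y = κ * D.ofP (inl ⟨0, c⟩) * κ⁻¹ := hκ.symm
    rw [h1, h2]
    group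
  have htM : t ∈ M := by
    refine ⟨ht, ?_⟩
    change D.ofP t ∈ N.map D.SG.subtype
    have h := FusionSystem.StronglyClosed.conj_mem hN hcM.2 (D.ofP g * κ)
    rw [← hjt] at h
    exact h (D.mem_SG.2 ⟨t, ht, rfl⟩)
  have htr : t.right = 1 := by
    by_contra h
    exact hMS (hM.eq_S hmodd hp hm1 htM h)
  have htl : t = inl t.left := by ext1 <;> simp [htr]
  -- Since `t ∈ Q` and `Q` is normal, conjugating back by `g` expresses `w` as an element of `Q`.
  have h3 := conj_inl hmodd g⁻¹ t.left
  refine ⟨_, (congrArg (QuotientGroup.mk' (centL p k m)) h3).symm.trans ?_⟩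
  rw [← htl, map_mul, map_mul, hgt, map_mul, map_mul]
  simp only [map_inv]
  group
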